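/- Throughout, a super-ring is a $\mathbb Z/2$-graded unital ring $R=R_0\oplus R_1$ that is super-commutative: elements of $R_0$ commute with all elements of $R_0$ and of $R_1$, and $y^2=0$ for every $y\in R_1$. A super-ideal is a homogeneous ideal; it is maximal if the quotient by it is a field. $R$ is Noetherian if its super-ideals satisfy the ascending chain condition, and local if it has exactly one maximal super-ideal. For a super-ideal $I$, the $I$-adic completion is the super-ring $\widehat R=\varprojlim_n R/I^n$, where $\widehat R_i$ consists of the families all of whose components are represented by elements of $R_i$. Let $R$ be a Noetherian super-ring with $\mathrm{Kdim}(R_0)<\infty$, where $\mathrm{Kdim}$ is the Krull dimension. Odd elements $y_1,\dots,y_s\in R_1$ form a system of odd parameters if $\mathrm{Kdim}(R_0)=\mathrm{Kdim}\bigl(R_0/\mathrm{Ann}_{R_0}(y_1\cdots y_s)\bigr)$, where $\mathrm{Ann}_{R_0}(x)=\{r\in R_0 : rx=0\}$ (for $s=0$ the product is $1$). The Krull super-dimension is $\mathrm{Ksdim}(R)=r\mid s$, where the even Krull dimension $r=\mathrm{Ksdim}_0(R)=\mathrm{Kdim}(R_0)$ and the odd Krull dimension $s=\mathrm{Ksdim}_1(R)$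 is the largest length of a system of odd parameters of $R$. **Theorem.** Let $A$ be a local Noetherian super-ring with maximal super-ideal $\mathfrak m$, and let $\widehat A$ be its $\mathfrak m$-adic completion. Then $\widehat A$ is Noetherian, $\mathrm{Ksdim}(A)$ is a pair of non-negative integers (so that both super-dimensions are defined), and $$\mathrm{Ksdim}(A)=\mathrm{Ksdim}(\widehat A),$$ that is, $\mathrm{Ksdim}_0(A)=\mathrm{Ksdim}_0(\widehat A)$ and $\mathrm{Ksdim}_1(A)=\mathrm{Ksdim}_1(\widehat A)$. -/

import Mathlib

/-- A `ℤ/2`-graded ring `A = A₀ ⊕ A₁` is super-commutative if even elements commute with all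
homogeneous elements and odd elements square to zero. -/
class IsSuperCommutative {A : Type*} [Ring A] (𝒜 : ZMod 2 → AddSubgroup A) [GradedRing 𝒜] :
    Prop where
  even_mul_even : ∀ r ∈ 𝒜 0, ∀ s ∈ 𝒜 0, r * s = s * r
  even_mul_odd : ∀ r ∈ 𝒜 0, ∀ s ∈ 𝒜 1, r * s = s * r
  odd_mul_self : ∀ s ∈ 𝒜 1, s * s = 0

namespace SuperRing

section Basic

variable {A : Type*} [Ring A] (𝒜 : ZMod 2 → AddSubgroup A) [GradedRing 𝒜]

theorem zmod_two_cases (i : ZMod 2) : i = 0 ∨ i = 1 := by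
  revert i; decide

theorem proj_add_proj (a : A) : GradedRing.proj 𝒜 0 a + GradedRing.proj 𝒜 1 a = a := by
  classical
  have h := DirectSum.sum_support_decompose 𝒜 a
  rw [Finset.sum_subset (Finset.subset_univ _)] at h
  · exact (Fin.sum_univ_two
      (fun i : ZMod 2 => ((DirectSum.decompose 𝒜 a i : 𝒜 i) : A))).symm.trans h
  · intro i _ hi
    simpa using hi

theorem proj_mem (i : ZMod 2) (a : A) : GradedRing.proj 𝒜 i a ∈ 𝒜 i :=
  SetLike.coe_mem (DirectSum.decompose 𝒜 a i)

variable {𝒜} in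
theorem pow_isHomogeneous (I : HomogeneousIdeal 𝒜) (n : ℕ) : (I.toIdeal ^ n).IsHomogeneous 𝒜 := by
  induction n with
  | zero =>
    intro i a _
    rw [Submodule.pow_zero, Ideal.one_eq_top]
    exact Submodule.mem_top
  | succ n ih =>
    intro i a ha
    change GradedRing.proj 𝒜 i a ∈ I.toIdeal ^ (n + 1)
    rw [Submodule.pow_succ] at ha ⊢
    refine Submodule.smul_induction_on (p := fun a => GradedRing.proj 𝒜 i a ∈ _) ha ?_ ?_
    · intro r hr x hx
      rw [smul_eq_mul, ← proj_add_proj 𝒜 x, mul_add, map_add]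
      have key : ∀ j, GradedRing.proj 𝒜 i (r * GradedRing.proj 𝒜 j x)
          ∈ I.toIdeal ^ n * I.toIdeal := by
        intro j
        have hxj : GradedRing.proj 𝒜 j x ∈ I.toIdeal := I.isHomogeneous j hx
        rw [← proj_add_proj 𝒜 r, add_mul, map_add]
        have key2 : ∀ k, GradedRing.proj 𝒜 i (GradedRing.proj 𝒜 k r * GradedRing.proj 𝒜 j x)
            ∈ I.toIdeal ^ n * I.toIdeal := by
          intro k
          have hrk : GradedRing.proj 𝒜 k r ∈ I.toIdeal ^ n := ih k hr
          have hm : GradedRing.proj 𝒜 k r * GradedRing.proj 𝒜 j x ∈ 𝒜 (k + j) :=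
            SetLike.mul_mem_graded (proj_mem 𝒜 k r) (proj_mem 𝒜 j x)
          by_cases h : k + j = i
          · subst h
            rw [GradedRing.proj_apply, DirectSum.decompose_of_mem_same 𝒜 hm]
            exact Ideal.mul_mem_mul hrk hxj
          · rw [GradedRing.proj_apply, DirectSum.decompose_of_mem_ne 𝒜 hm h]
            exact zero_mem _
        exact add_mem (key2 0) (key2 1)
      exact add_mem (key 0) (key 1)
    · intro x y hx hy
      rw [map_add]
      exact add_mem hx hy

variable {𝒜} in
theorem even_comm [IsSuperCommutative 𝒜] {r : A} (hr : r ∈ 𝒜 0) (a : A) : r * a = a * r := by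
  rw [← proj_add_proj 𝒜 a, mul_add, add_mul,
    IsSuperCommutative.even_mul_even r hr _ (proj_mem 𝒜 0 a),
    IsSuperCommutative.even_mul_odd r hr _ (proj_mem 𝒜 1 a)]

variable {𝒜} in
theorem odd_anticomm [IsSuperCommutative 𝒜] {r s : A} (hr : r ∈ 𝒜 1) (hs : s ∈ 𝒜 1) :
    r * s = -(s * r) := by
  have h := IsSuperCommutative.odd_mul_self (𝒜 := 𝒜) (r + s) ((𝒜 1).add_mem hr hs)
  have h1 := IsSuperCommutative.odd_mul_self (𝒜 := 𝒜) r hr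
  have h2 := IsSuperCommutative.odd_mul_self (𝒜 := 𝒜) s hs
  rw [add_mul, mul_add, mul_add, h1, h2, zero_add, add_zero] at h
  exact eq_neg_of_add_eq_zero_left h

/-- The even part `A₀`, as a subring of `A`. -/
def evenPart : Subring A := SetLike.GradeZero.subring 𝒜

theorem mem_evenPart {a : A} : a ∈ evenPart 𝒜 ↔ a ∈ 𝒜 0 := Iff.rfl

instance evenPart.instCommRing [IsSuperCommutative 𝒜] : CommRing (evenPart 𝒜) :=
  { (inferInstance : Ring (evenPart 𝒜)) with
    mul_comm := fun a b => Subtype.ext (even_comm (𝒜 := 𝒜) a.2 b.1) }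

/-- A super-ring is Noetherian if its super-ideals (homogeneous ideals) satisfy the ascending
chain condition. -/
def IsNoetherianSuper : Prop := WellFoundedGT (HomogeneousIdeal 𝒜)

variable {𝒜} in
/-- Super-ideals of a super-commutative super-ring are two-sided. -/
instance instIsTwoSided [IsSuperCommutative 𝒜] (I : HomogeneousIdeal 𝒜) :
    I.toIdeal.IsTwoSided := by
  refine ⟨fun {a} b ha => ?_⟩
  have h0 : GradedRing.proj 𝒜 0 a ∈ I.toIdeal := I.isHomogeneous 0 ha
  have h1 : GradedRing.proj 𝒜 1 a ∈ I.toIdeal := I.isHomogeneous 1 ha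
  rw [← proj_add_proj 𝒜 a, ← proj_add_proj 𝒜 b, add_mul, mul_add, mul_add,
    even_comm (proj_mem 𝒜 0 a), even_comm (proj_mem 𝒜 0 a),
    ← even_comm (proj_mem 𝒜 0 b) (GradedRing.proj 𝒜 1 a),
    odd_anticomm (proj_mem 𝒜 1 a) (proj_mem 𝒜 1 b)]
  exact add_mem (add_mem (Ideal.mul_mem_left _ _ h0) (Ideal.mul_mem_left _ _ h0))
    (add_mem (Ideal.mul_mem_left _ _ h1) (neg_mem (Ideal.mul_mem_left _ _ h1)))

variable {𝒜} in
/-- A super-ideal `𝔪` is maximal if the quotient ring `A / 𝔪` is a field. -/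
def IsMaximalSuperIdeal [IsSuperCommutative 𝒜] (m : HomogeneousIdeal 𝒜) : Prop :=
  IsField (A ⧸ m.toIdeal)

/-- `A` is a local super-ring with (unique) maximal super-ideal `𝔪`. -/
def IsLocalWith [IsSuperCommutative 𝒜] (m : HomogeneousIdeal 𝒜) : Prop :=
  IsMaximalSuperIdeal m ∧ ∀ n : HomogeneousIdeal 𝒜, IsMaximalSuperIdeal n → n = m

section KrullSuperDimension

variable [IsSuperCommutative 𝒜]

/-- `Ann_{A₀}(x)`, the ideal of all `r ∈ A₀` with `r x = 0`. -/
def evenAnn (x : A) : Ideal (evenPart 𝒜) where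
  carrier := {r | (r : A) * x = 0}
  add_mem' := by
    intro a b ha hb
    change ((a : A) + b) * x = 0
    rw [add_mul, show (a : A) * x = 0 from ha, show (b : A) * x = 0 from hb, add_zero]
  zero_mem' := zero_mul x
  smul_mem' := by
    intro c a ha
    change ((c : A) * a) * x = 0
    rw [mul_assoc, show (a : A) * x = 0 from ha, mul_zero]

/-- The odd elements `y₁, …, yₛ` form a system of odd parameters:
`Kdim A₀ = Kdim (A₀ / Ann_{A₀}(y₁ ⋯ yₛ))`. -/
def IsSystemOfOddParameters {s : ℕ} (y : Fin s → A) : Prop :=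
  (∀ i, y i ∈ 𝒜 1) ∧
    ringKrullDim (evenPart 𝒜) =
      ringKrullDim (evenPart 𝒜 ⧸ evenAnn 𝒜 (List.ofFn y).prod)

/-- The even Krull dimension `Ksdim₀(A) = Kdim(A₀)`. -/
noncomputable def evenKrullDim : WithBot ℕ∞ := ringKrullDim (evenPart 𝒜)

/-- The odd Krull dimension `Ksdim₁(A)`: the largest length of a system of odd parameters
(as a supremum in `ℕ∞`; the empty system always qualifies). -/
noncomputable def oddKrullDim : ℕ∞ :=
  ⨆ (s : ℕ) (_ : ∃ y : Fin s → A, IsSystemOfOddParameters 𝒜 y), (s : ℕ∞)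

/-- The Krull super-dimension `Ksdim(A) = r | s`. -/
noncomputable def Ksdim : WithBot ℕ∞ × ℕ∞ := (evenKrullDim 𝒜, oddKrullDim 𝒜)

end KrullSuperDimension

end Basic

section Completion

variable {A : Type*} [Ring A] {𝒜 : ZMod 2 → AddSubgroup A} [GradedRing 𝒜] [IsSuperCommutative 𝒜]
  (I : HomogeneousIdeal 𝒜)

/-- The subring of compatible families in `∏ₙ A / Iⁿ`. -/
def completionSubring : Subring (∀ n : ℕ, A ⧸ I.toIdeal ^ n) where
  carrier := {x | ∀ m n : ℕ, ∀ h : m ≤ n,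
    Ideal.Quotient.factor (Ideal.pow_le_pow_right h) (x n) = x m}
  mul_mem' := fun hx hy m n h => by simp [hx m n h, hy m n h]
  one_mem' := fun m n h => by simp
  add_mem' := fun hx hy m n h => by simp [hx m n h, hy m n h]
  zero_mem' := fun m n h => by simp
  neg_mem' := fun hx m n h => by simp [hx m n h]

/-- The `I`-adic completion `lim A / Iⁿ` of a super-ring along a super-ideal `I`. -/
def Completion : Type _ := completionSubring I

instance Completion.instRing : Ring (Completion I) :=
  inferInstanceAs (Ring (completionSubring I))

/-- The grading of the completion: `x` has degree `i` if each component `xₙ ∈ A / Iⁿ` is the class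
of an element of `Aᵢ`. -/
def completionGrading (i : ZMod 2) : AddSubgroup (Completion I) where
  carrier := {x | ∀ n, ∃ a ∈ 𝒜 i, Ideal.Quotient.mk (I.toIdeal ^ n) a = x.1 n}
  add_mem' := by
    intro x y hx hy n
    obtain ⟨a, ha, hax⟩ := hx n
    obtain ⟨b, hb, hby⟩ := hy n
    exact ⟨a + b, add_mem ha hb, by rw [map_add, hax, hby]; rfl⟩
  zero_mem' := fun n => ⟨0, zero_mem _, map_zero (Ideal.Quotient.mk (I.toIdeal ^ n))⟩
  neg_mem' := by
    intro x hx n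
    obtain ⟨a, ha, hax⟩ := hx n
    exact ⟨-a, neg_mem ha, by rw [map_neg, hax]; rfl⟩

theorem completionGrading_disjoint {x : Completion I} (h0 : x ∈ completionGrading I 0)
    (h1 : x ∈ completionGrading I 1) : x = 0 := by
  refine Subtype.ext (funext fun n => ?_)
  obtain ⟨a, ha, hax⟩ := h0 n
  obtain ⟨b, hb, hbx⟩ := h1 n
  have hab : a - b ∈ I.toIdeal ^ n := Ideal.Quotient.eq.1 (hax.trans hbx.symm)
  have hp : GradedRing.proj 𝒜 0 (a - b) ∈ I.toIdeal ^ n := pow_isHomogeneous I n 0 hab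
  rw [map_sub, GradedRing.proj_apply, GradedRing.proj_apply,
    DirectSum.decompose_of_mem_same 𝒜 ha,
    DirectSum.decompose_of_mem_ne 𝒜 hb (by decide), sub_zero] at hp
  rw [← hax, Ideal.Quotient.eq_zero_iff_mem.2 hp]
  rfl

theorem exists_completionGrading_add (x : Completion I) :
    ∃ x0 ∈ completionGrading I 0, ∃ x1 ∈ completionGrading I 1, x0 + x1 = x := by
  choose a ha using fun n => Ideal.Quotient.mk_surjective (x.1 n)
  have hc : ∀ i : ZMod 2, (fun n => Ideal.Quotient.mk (I.toIdeal ^ n) (GradedRing.proj 𝒜 i (a n)))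
      ∈ completionSubring I := by
    intro i m n h
    rw [Ideal.Quotient.factor_mk, Ideal.Quotient.eq, ← map_sub]
    refine pow_isHomogeneous I m i (Ideal.Quotient.eq.1 ?_)
    rw [ha m, ← x.2 m n h, ← ha n, Ideal.Quotient.factor_mk]
  refine ⟨⟨_, hc 0⟩, fun n => ⟨_, proj_mem 𝒜 0 (a n), rfl⟩,
    ⟨_, hc 1⟩, fun n => ⟨_, proj_mem 𝒜 1 (a n), rfl⟩, Subtype.ext (funext fun n => ?_)⟩
  change Ideal.Quotient.mk (I.toIdeal ^ n) (GradedRing.proj 𝒜 0 (a n))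
    + Ideal.Quotient.mk (I.toIdeal ^ n) (GradedRing.proj 𝒜 1 (a n)) = x.1 n
  rw [← map_add, proj_add_proj, ha]

instance completionGrading.instGradedMonoid : SetLike.GradedMonoid (completionGrading I) where
  one_mem := fun n => ⟨1, SetLike.one_mem_graded 𝒜, map_one _⟩
  mul_mem := by
    intro i j x y hx hy n
    obtain ⟨a, ha, hax⟩ := hx n
    obtain ⟨b, hb, hby⟩ := hy n
    exact ⟨a * b, SetLike.mul_mem_graded ha hb, by rw [map_mul, hax, hby]; rfl⟩

theorem completionGrading_isInternal : DirectSum.IsInternal (completionGrading I) := by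
  have hsplit : ∀ f : DirectSum (ZMod 2) fun i => completionGrading I i,
      f = DirectSum.of (fun i => completionGrading I i) 0 (f 0)
        + DirectSum.of (fun i => completionGrading I i) 1 (f 1) := by
    intro f
    refine DFinsupp.ext fun i => ?_
    rcases zmod_two_cases i with rfl | rfl
    · rw [DirectSum.add_apply, DirectSum.of_eq_same, DirectSum.of_eq_of_ne _ _ _ (by decide),
        add_zero]
    · rw [DirectSum.add_apply, DirectSum.of_eq_same, DirectSum.of_eq_of_ne _ _ _ (by decide),
        zero_add]
  constructor
  · rw [injective_iff_map_eq_zero]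
    intro f hf
    rw [hsplit f, map_add, DirectSum.coeAddMonoidHom_of, DirectSum.coeAddMonoidHom_of] at hf
    have e0 := eq_neg_of_add_eq_zero_left hf
    have h0 := completionGrading_disjoint I (f 0).2
      (e0.symm ▸ (completionGrading I 1).neg_mem (f 1).2)
    rw [h0, zero_add] at hf
    have k0 : f 0 = 0 := Subtype.ext h0
    have k1 : f 1 = 0 := Subtype.ext hf
    refine DFinsupp.ext fun i => ?_
    rcases zmod_two_cases i with rfl | rfl
    · exact k0
    · exact k1
  · intro x
    obtain ⟨x0, h0, x1, h1, hx⟩ := exists_completionGrading_add I x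
    refine ⟨DirectSum.of (fun i => completionGrading I i) 0 ⟨x0, h0⟩
      + DirectSum.of (fun i => completionGrading I i) 1 ⟨x1, h1⟩, ?_⟩
    rw [map_add, DirectSum.coeAddMonoidHom_of, DirectSum.coeAddMonoidHom_of]
    exact hx

noncomputable instance completionGrading.instDecomposition :
    DirectSum.Decomposition (completionGrading I) :=
  (completionGrading_isInternal I).chooseDecomposition

/-- The completion is again a super-ring. -/
noncomputable instance completionGrading.instGradedRing : GradedRing (completionGrading I) where
  toGradedMonoid := completionGrading.instGradedMonoid I
  toDecomposition := completionGrading.instDecomposition I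

/-- The completion is again super-commutative. -/
instance completionGrading.instIsSuperCommutative : IsSuperCommutative (completionGrading I) where
  even_mul_even := by
    intro x hx y hy
    refine Subtype.ext (funext fun n => ?_)
    obtain ⟨a, ha, hax⟩ := hx n
    obtain ⟨b, hb, hby⟩ := hy n
    change x.1 n * y.1 n = y.1 n * x.1 n
    rw [← hax, ← hby, ← map_mul, ← map_mul, even_comm ha]
  even_mul_odd := by
    intro x hx y hy
    refine Subtype.ext (funext fun n => ?_)
    obtain ⟨a, ha, hax⟩ := hx n
    obtain ⟨b, hb, hby⟩ := hy n
    change x.1 n * y.1 n = y.1 n * x.1 n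
    rw [← hax, ← hby, ← map_mul, ← map_mul, even_comm ha]
  odd_mul_self := by
    intro x hx
    refine Subtype.ext (funext fun n => ?_)
    obtain ⟨a, ha, hax⟩ := hx n
    change x.1 n * x.1 n = 0
    rw [← hax, ← map_mul, IsSuperCommutative.odd_mul_self a ha, map_zero]

end Completion

end SuperRing

/-! Everything reduces to commutative algebra over the even part. Write `A₀`, `A₁` for the
homogeneous components and `𝔪₀` for the even part of `𝔪`. The ring `A₀` is Noetherian local with
maximal ideal `𝔪₀`, and `A` is a finite `A₀`-module. Odd elements anticommute and square to zero, so
some power of `A₁` vanishes; hence the `𝔪`-adic and `𝔪₀`-adic topologies on `A` agree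
(`pow_mem_smul_top`), and the completion is that of a finite module over a Noetherian local ring. An
Artin–Rees argument with leading terms makes it Noetherian over its own even part
(`IsFilteredCompletion.isNoetherian`).

For the dimensions, the key is that `A₀ / Ann z` and the corresponding quotient for the image of `z`
have equal Krull dimension for every `z` in `A` (`ringKrullDim_quotient_evenAnn`). Taking `z = 1`
compares the even dimensions; taking `z = y₁ ⋯ yₛ` carries systems of odd parameters into the
completion.

Conversely, finitely many generators of `A₁` also generate the odd part of the completion. A product
of `s` odd elements there is a combination of products of these generators, so its annihilator
contains a finite intersection of their annihilators. A longest chain of primes over it then lies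
over one of these (`exists_ringKrullDim_quotient_eq`), which gives a system of odd parameters coming
from `A`. -/

namespace SuperRing

/-! ### Modules that behave like adic completions: generation, Noetherianity, locality. -/

section FilteredCompletion

theorem exists_sum_smul_of_mem_smul_span {R M ι : Type*} [CommRing R] [AddCommGroup M] [Module R M]
    [Fintype ι] {J : Ideal R} {a : ι → M} {x : M}
    (hx : x ∈ J • Submodule.span R (Set.range a)) :
    ∃ r : ι → R, (∀ i, r i ∈ J) ∧ ∑ i, r i • a i = x := by
  obtain ⟨c, hc, rfl⟩ := (Submodule.mem_ideal_smul_span_iff_exists_sum J a x).1 hx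
  exact ⟨c, hc, (Finsupp.sum_fintype c (fun i r => r • a i) fun i => zero_smul R (a i)).symm⟩

/-- The module `C` over `S`, with the filtrations `F` of `S` and `G` of `C`, behaves like the
`I`-adic completion of the `R`-module `M`. -/
structure IsFilteredCompletion {R S M C : Type*} [CommRing R] [CommRing S] [AddCommGroup M]
    [Module R M] [AddCommGroup C] [Module S C] (I : Ideal R) (φ : R →+* S) (f : M →ₛₗ[φ] C)
    (F : ℕ → Ideal S) (G : ℕ → Submodule S C) : Prop where
  complete : ∀ s : ℕ → S, (∀ n, s n ∈ F n) → ∃ t, ∀ n, t - ∑ i ∈ Finset.range n, s i ∈ F n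
  smul_mem : ∀ {k l s x}, s ∈ F k → x ∈ G l → s • x ∈ G (k + l)
  antitone : Antitone G
  separated : ∀ x, (∀ n, x ∈ G n) → x = 0
  zero_eq : G 0 = ⊤
  map_mem_ideal : ∀ {n r}, r ∈ I ^ n → φ r ∈ F n
  map_mem : ∀ {n a}, a ∈ I ^ n • (⊤ : Submodule R M) → f a ∈ G n
  exists_approx : ∀ n, ∀ x ∈ G n, ∃ a ∈ I ^ n • (⊤ : Submodule R M), x - f a ∈ G (n + 1)

namespace IsFilteredCompletion

variable {R S M C : Type*} [CommRing R] [CommRing S] [AddCommGroup M]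
    [Module R M] [AddCommGroup C] [Module S C] {I : Ideal R} {φ : R →+* S} {f : M →ₛₗ[φ] C}
    {F : ℕ → Ideal S} {G : ℕ → Submodule S C}

/-- Successive approximation: elements that can be approximated step by step by combinations of
finitely many elements are combinations of these elements. -/
theorem mem_span_of_approx (h : IsFilteredCompletion I φ f F G) {ι : Type*} [Fintype ι]
    (D : Submodule S C) (d : ℕ) (g : ι → C) (hg : ∀ i, g i ∈ G d)
    (step : ∀ k, ∀ x ∈ D ⊓ G (d + k), ∃ c : ι → S, (∀ i, c i ∈ F k) ∧
      x - ∑ i, c i • g i ∈ D ⊓ G (d + (k + 1)))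
    {x : C} (hx : x ∈ D ⊓ G d) : x ∈ Submodule.span S (Set.range g) := by
  choose! c hc hc' using step
  -- `y k` is the remainder after `k` corrections. The `k`-th coefficients lie in `F k`, so their
  -- series converge by `complete`.
  let y : ℕ → C := fun n => Nat.rec x (fun k z => z - ∑ i, c k z i • g i) n
  have hy0 : y 0 = x := rfl
  have hys : ∀ k, y (k + 1) = y k - ∑ i, c k (y k) i • g i := fun k => rfl
  have hy : ∀ k, y k ∈ D ⊓ G (d + k) := by
    intro k
    induction k with
    | zero => exact hx
    | succ k ih => rw [hys]; exact hc' k _ ih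
  choose t ht using fun i => h.complete (fun k => c k (y k) i) (fun k => hc k _ (hy k) i)
  have hsum : ∀ n, x - ∑ i, (∑ k ∈ Finset.range n, c k (y k) i) • g i = y n := by
    intro n
    induction n with
    | zero => simp [hy0]
    | succ n ih =>
      simp_rw [Finset.sum_range_succ, add_smul, Finset.sum_add_distrib]
      rw [hys, ← ih]; abel
  have key : x - ∑ i, t i • g i = 0 := by
    refine h.separated _ fun n => h.antitone (Nat.le_add_left n d) ?_
    have e : x - ∑ i, t i • g i =
        y n - ∑ i, (t i - ∑ k ∈ Finset.range n, c k (y k) i) • g i := by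
      simp_rw [sub_smul, Finset.sum_sub_distrib]
      rw [← hsum n]; abel
    rw [e]
    refine sub_mem (hy n).2 (sum_mem fun i _ => ?_)
    rw [add_comm]
    exact h.smul_mem (ht i n) (hg i)
  rw [sub_eq_zero.1 key]
  exact sum_mem fun i _ => Submodule.smul_mem _ _ (Submodule.subset_span ⟨i, rfl⟩)

theorem map_sum_smul {ι : Type*} [Fintype ι] (r : ι → R) (a : ι → M) :
    f (∑ i, r i • a i) = ∑ i, φ (r i) • f (a i) := by
  simp [map_sum]

theorem exists_sub_mem (h : IsFilteredCompletion I φ f F G) (n : ℕ) (x : C) :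
    ∃ a, x - f a ∈ G n := by
  induction n with
  | zero => exact ⟨0, by rw [h.zero_eq]; trivial⟩
  | succ d ih =>
    obtain ⟨e, he⟩ := ih
    obtain ⟨e', -, he'⟩ := h.exists_approx _ _ he
    exact ⟨e + e', by rwa [map_add, ← sub_sub]⟩

/-- A remainder in `G (n + k)` is approximated from `I ^ k • (I ^ n • ⊤)`, so finitely many
generators of `I ^ n • ⊤` suffice, with coefficients from `I ^ k`. For `M = R` this shows that the
filtration is adic. -/
theorem le_span_map (h : IsFilteredCompletion I φ f F G) [IsNoetherian R M] (n : ℕ) :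
    G n ≤ Submodule.span S (f '' ((I ^ n • (⊤ : Submodule R M) : Submodule R M) : Set M)) := by
  obtain ⟨q, a, ha⟩ := Submodule.fg_iff_exists_fin_generating_family.1
    (IsNoetherian.noetherian (I ^ n • (⊤ : Submodule R M)))
  have ha' : ∀ i, a i ∈ I ^ n • (⊤ : Submodule R M) := fun i => by
    rw [← ha]; exact Submodule.subset_span ⟨i, rfl⟩
  intro x hx
  refine Submodule.span_mono ?_ (h.mem_span_of_approx ⊤ n (fun i => f (a i))
    (fun i => h.map_mem (ha' i)) ?_ ⟨trivial, hx⟩)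
  · rintro _ ⟨i, rfl⟩
    exact ⟨a i, ha' i, rfl⟩
  · rintro k y ⟨-, hy⟩
    obtain ⟨b, hb, hyb⟩ := h.exists_approx _ y hy
    rw [add_comm n k, pow_add, mul_smul, ← ha] at hb
    obtain ⟨r, hr, rfl⟩ := exists_sum_smul_of_mem_smul_span hb
    refine ⟨fun i => φ (r i), fun i => h.map_mem_ideal (hr i), trivial, ?_⟩
    rwa [← map_sum_smul]

/-- The leading terms of a submodule `D` form a filtration on `M` contained in the `I`-adic one,
hence stable by Artin–Rees. Finitely many leading terms therefore control `D ⊓ G d` for some `d`,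
and finitely many further elements account for `D` modulo `G d`. -/
theorem isNoetherian (h : IsFilteredCompletion I φ f F G) [IsNoetherianRing R]
    [Module.Finite R M] : IsNoetherian S C := by
  refine ⟨fun D => ?_⟩
  -- Degree `n` collects the elements of `I ^ n • ⊤` whose image agrees with an element of `D` up to
  -- `G (n + 1)`.
  let N : I.Filtration M :=
    { N := fun n => I ^ n • (⊤ : Submodule R M) ⊓ (D ⊔ G (n + 1)).comap f
      mono := fun n => inf_le_inf (Submodule.smul_mono_left (Ideal.pow_le_pow_right n.le_succ))
        (Submodule.comap_mono (sup_le_sup_left (h.antitone (Nat.le_succ _)) _))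
      smul_le := fun n => by
        rw [Submodule.smul_le]
        rintro r hr a ⟨ha, hfa⟩
        refine ⟨?_, ?_⟩
        · rw [pow_succ', mul_smul]
          exact Submodule.smul_mem_smul hr ha
        · change f (r • a) ∈ D ⊔ G (n + 1 + 1)
          rw [map_smulₛₗ]
          obtain ⟨x, hx, y, hy, hxy⟩ := Submodule.mem_sup.1 (Submodule.mem_comap.1 hfa)
          rw [← hxy, smul_add]
          refine Submodule.add_mem_sup (D.smul_mem _ hx) ?_
          rw [add_comm (n + 1)]
          exact h.smul_mem (h.map_mem_ideal (by rwa [pow_one])) hy }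
  have hN : N.Stable := (I.stableFiltration_stable ⊤).of_le fun n => inf_le_left
  obtain ⟨d, hd⟩ := hN.exists_pow_smul_eq
  obtain ⟨q, a, ha⟩ := Submodule.fg_iff_exists_fin_generating_family.1
    (IsNoetherian.noetherian (N.N d))
  obtain ⟨p, b, hb⟩ := Submodule.fg_iff_exists_fin_generating_family.1
    (IsNoetherian.noetherian ((D ⊔ G d).comap f))
  have ha' : ∀ i, a i ∈ N.N d := fun i => by rw [← ha]; exact Submodule.subset_span ⟨i, rfl⟩
  have hb' : ∀ i, f (b i) ∈ D ⊔ G d := fun i => by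
    rw [← Submodule.mem_comap, ← hb]; exact Submodule.subset_span ⟨i, rfl⟩
  -- `u` lifts the generators in degree `d` to `D`, with errors `v` one step deeper; `u'` does the
  -- same for `D` modulo `G d`.
  choose u hu v hv huv using fun i => Submodule.mem_sup.1 (Submodule.mem_comap.1 (ha' i).2)
  choose u' hu' v' hv' huv' using fun i => Submodule.mem_sup.1 (hb' i)
  have hud : ∀ i, u i ∈ G d := fun i => by
    rw [eq_sub_of_add_eq (huv i)]
    exact sub_mem (h.map_mem (ha' i).1) (h.antitone (Nat.le_succ _) (hv i))
  have h1 : ∀ x ∈ D ⊓ G d, x ∈ Submodule.span S (Set.range u) := by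
    intro x hx
    refine h.mem_span_of_approx D d u hud ?_ hx
    rintro k y ⟨hyD, hy⟩
    obtain ⟨e, he, hye⟩ := h.exists_approx _ y hy
    have heN : e ∈ N.N (d + k) := by
      refine ⟨he, ?_⟩
      change f e ∈ D ⊔ G (d + k + 1)
      rw [show f e = y - (y - f e) by abel]
      exact sub_mem (Submodule.mem_sup_left hyD) (Submodule.mem_sup_right hye)
    rw [hd, ← ha] at heN
    obtain ⟨r, hr, rfl⟩ := exists_sum_smul_of_mem_smul_span heN
    refine ⟨fun i => φ (r i), fun i => h.map_mem_ideal (hr i),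
      sub_mem hyD (sum_mem fun i _ => D.smul_mem _ (hu i)), ?_⟩
    have e : y - ∑ i, φ (r i) • u i = (y - f (∑ i, r i • a i)) + ∑ i, φ (r i) • v i := by
      rw [map_sum_smul]
      simp_rw [← huv, smul_add, Finset.sum_add_distrib]
      abel
    rw [e]
    refine add_mem hye (sum_mem fun i _ => ?_)
    rw [← add_assoc, add_comm d k, add_assoc]
    exact h.smul_mem (h.map_mem_ideal (hr i)) (hv i)
  have h2 : D ≤ Submodule.span S (Set.range u ∪ Set.range u') := by
    intro x hx
    obtain ⟨e, he⟩ := h.exists_sub_mem d x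
    have heN : e ∈ (⊤ : Ideal R) • Submodule.span R (Set.range b) := by
      rw [Submodule.top_smul, hb]
      change f e ∈ D ⊔ G d
      rw [show f e = x - (x - f e) by abel]
      exact sub_mem (Submodule.mem_sup_left hx) (Submodule.mem_sup_right he)
    obtain ⟨r, -, rfl⟩ := exists_sum_smul_of_mem_smul_span heN
    have h3 : x - ∑ i, φ (r i) • u' i ∈ D ⊓ G d := by
      refine ⟨sub_mem hx (sum_mem fun i _ => D.smul_mem _ (hu' i)), ?_⟩
      have e : x - ∑ i, φ (r i) • u' i = (x - f (∑ i, r i • b i)) + ∑ i, φ (r i) • v' i := by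
        rw [map_sum_smul]
        simp_rw [← huv', smul_add, Finset.sum_add_distrib]
        abel
      rw [e]
      exact add_mem he (sum_mem fun i _ => (G d).smul_mem _ (hv' i))
    rw [← sub_add_cancel x (∑ i, φ (r i) • u' i)]
    exact add_mem (Submodule.span_mono Set.subset_union_left (h1 _ h3))
      (sum_mem fun i _ => Submodule.smul_mem _ _
        (Submodule.subset_span (Or.inr ⟨i, rfl⟩)))
  have h3 : D = Submodule.span S (Set.range u ∪ Set.range u') := by
    refine le_antisymm h2 (Submodule.span_le.2 ?_)
    rintro _ (⟨i, rfl⟩ | ⟨i, rfl⟩)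
    exacts [hu i, hu' i]
  rw [h3]
  exact Submodule.fg_span ((Set.finite_range u).union (Set.finite_range u'))

/-- A filtered completion of a local ring is local, with maximal ideal the first step of the
filtration. -/
theorem isLocalRing {R S : Type*} [CommRing R] [CommRing S] [IsLocalRing R] {φ : R →+* S}
    {f : R →ₛₗ[φ] S} {F : ℕ → Ideal S}
    (h : IsFilteredCompletion (IsLocalRing.maximalIdeal R) φ f F F) (hf : ∀ r, f r = φ r)
    (h1 : F 1 ≠ ⊤) :
    ∃ _ : IsLocalRing S, IsLocalRing.maximalIdeal S = F 1 := by
  -- The inverse is the sum of the geometric series.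
  have key : ∀ x ∈ F 1, IsUnit (1 - x) := by
    intro x hx
    have hxn : ∀ n, x ^ n ∈ F n := by
      intro n
      induction n with
      | zero => rw [h.zero_eq]; trivial
      | succ n ih => rw [pow_succ]; exact h.smul_mem ih hx
    obtain ⟨t, ht⟩ := h.complete (fun n => x ^ n) hxn
    refine IsUnit.of_mul_eq_one t (sub_eq_zero.1 (h.separated _ fun n => ?_))
    have e : (1 - x) * t - 1 = (1 - x) * (t - ∑ i ∈ Finset.range n, x ^ i) - x ^ n := by
      rw [mul_sub, mul_neg_geom_sum]; ring
    rw [e]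
    exact sub_mem (Ideal.mul_mem_left _ _ (ht n)) (hxn n)
  have hu : ∀ s, s ∉ F 1 → IsUnit s := by
    intro s hs
    obtain ⟨r, -, hr⟩ := h.exists_approx 0 s (by rw [h.zero_eq]; trivial)
    rw [hf, zero_add] at hr
    -- If `r` were in the maximal ideal, then `φ r`, and with it `s`, would lie in `F 1`.
    have hru : IsUnit r := by
      by_contra hr'
      refine hs ?_
      rw [← sub_add_cancel s (φ r)]
      refine add_mem hr (h.map_mem_ideal ?_)
      rw [pow_one]
      exact hr'
    obtain ⟨v, hv⟩ := hru.exists_right_inv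
    have hv' : φ r * φ v = 1 := by rw [← map_mul, hv, map_one]
    have e : s = φ r * (1 - -(φ v * (s - φ r))) := by
      linear_combination (φ r - s) * hv'
    rw [e]
    exact (hru.map φ).mul (key _ (neg_mem (Ideal.mul_mem_left _ _ hr)))
  have hnu : ∀ s, s ∈ nonunits S ↔ s ∈ F 1 := by
    refine fun s => ⟨fun h => by_contra fun h' => h (hu s h'), fun hs hs' => ?_⟩
    exact h1 (Ideal.eq_top_of_isUnit_mem _ hs hs')
  have : Nontrivial S := by
    by_contra hS
    rw [not_nontrivial_iff_subsingleton] at hS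
    exact h1 (Subsingleton.elim _ _)
  refine ⟨IsLocalRing.of_nonunits_add fun a b ha hb => ?_, Ideal.ext hnu⟩
  rw [hnu] at *
  exact add_mem ha hb

end IsFilteredCompletion

end FilteredCompletion

/-! ### Krull dimension of Noetherian local rings through systems of parameters. -/

section Dimension

open IsLocalRing

/-- The maximal ideal is a minimal prime over the span, so Krull's height theorem applies. -/
theorem ringKrullDim_le_card_of_pow_le_span {R : Type*} [CommRing R] [IsLocalRing R]
    [IsNoetherianRing R] (s : Finset R) (n : ℕ) (hs : (s : Set R) ⊆ maximalIdeal R)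
    (h : maximalIdeal R ^ n ≤ Ideal.span (s : Set R)) : ringKrullDim R ≤ s.card := by
  rw [← IsLocalRing.maximalIdeal_height_eq_ringKrullDim]
  have hmin : maximalIdeal R ∈ (Ideal.span (s : Set R)).minimalPrimes := by
    refine ⟨⟨inferInstance, Ideal.span_le.2 hs⟩, ?_⟩
    rintro p ⟨hp, hsp⟩ -
    exact hp.le_of_pow_le (h.trans hsp)
  exact_mod_cast Ideal.height_le_card_of_mem_minimalPrimes_span_finset hmin

theorem exists_finset_pow_le_span (R : Type*) [CommRing R] [IsLocalRing R]
    [IsNoetherianRing R] : ∃ s : Finset R, ∃ n : ℕ, (s : Set R) ⊆ maximalIdeal R ∧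
      maximalIdeal R ^ n ≤ Ideal.span (s : Set R) ∧ ringKrullDim R = s.card := by
  obtain ⟨s, hs, hc⟩ := (maximalIdeal R).exists_finset_card_eq_height_of_isNoetherianRing
  obtain ⟨n, hn⟩ := (Ideal.span (s : Set R)).exists_radical_pow_le_of_fg
    (IsNoetherian.noetherian _)
  refine ⟨s, n, Ideal.span_le.1 hs.1.2, (Ideal.pow_right_mono ?_ n).trans hn, ?_⟩
  · rw [Ideal.radical_eq_sInf]
    refine le_sInf ?_
    rintro p ⟨hsp, hp⟩
    exact hs.2 ⟨hp, hsp⟩ (IsLocalRing.le_maximalIdeal hp.ne_top)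
  · rw [← IsLocalRing.maximalIdeal_height_eq_ringKrullDim, ← hc]
    rfl

/-- A homomorphism of Noetherian local rings which induces, up to cofinality, isomorphisms
modulo the powers of the maximal ideals preserves the Krull dimension. -/
theorem ringKrullDim_eq_of_dense {R S : Type*} [CommRing R] [IsLocalRing R] [IsNoetherianRing R]
    [CommRing S] [IsLocalRing S] [IsNoetherianRing S] (φ : R →+* S)
    (hmap : (maximalIdeal R).map φ = maximalIdeal S)
    (hdense : ∀ n, ∀ x : S, ∃ r, x - φ r ∈ maximalIdeal S ^ n)
    (hcomap : ∀ n, ∃ k, ∀ r, φ r ∈ maximalIdeal S ^ k → r ∈ maximalIdeal R ^ n) :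
    ringKrullDim R = ringKrullDim S := by
  classical
  refine le_antisymm ?_ ?_
  -- Parameters of `S` are perturbed to images of elements of `R`. An error in the power `n + 1` is
  -- absorbed by Nakayama; precision `k` is what lets the containment descend to `R`, where Nakayama
  -- is used again.
  · obtain ⟨s, n, hsm, hsn, hs⟩ := exists_finset_pow_le_span S
    obtain ⟨k, hk⟩ := hcomap (n + 1)
    choose a ha using hdense (max k (n + 1))
    have hak : ∀ x, x - φ (a x) ∈ maximalIdeal S ^ k := fun x =>
      Ideal.pow_le_pow_right (le_max_left _ _) (ha x)
    have han : ∀ x, x - φ (a x) ∈ maximalIdeal S ^ (n + 1) := fun x =>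
      Ideal.pow_le_pow_right (le_max_right _ _) (ha x)
    have h1 : maximalIdeal S ^ n ≤ Ideal.span (φ '' (a '' s)) := by
      refine Submodule.le_of_le_smul_of_le_jacobson_bot (I := maximalIdeal S)
        (IsNoetherian.noetherian _) (IsLocalRing.maximalIdeal_le_jacobson _) ?_
      refine hsn.trans (Ideal.span_le.2 fun x hx => ?_)
      rw [smul_eq_mul, ← pow_succ', ← add_sub_cancel (φ (a x)) x]
      exact Submodule.add_mem_sup (Ideal.subset_span ⟨_, ⟨x, hx, rfl⟩, rfl⟩) (han x)
    have h2 : maximalIdeal R ^ n ≤ Ideal.span (a '' s) := by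
      refine Submodule.le_of_le_smul_of_le_jacobson_bot (I := maximalIdeal R)
        (IsNoetherian.noetherian _) (IsLocalRing.maximalIdeal_le_jacobson _) fun r hr => ?_
      rw [smul_eq_mul, ← pow_succ']
      have hφr : φ r ∈ Ideal.span (φ '' (a '' s)) := h1 (by
        rw [← hmap, ← Ideal.map_pow]; exact Ideal.mem_map_of_mem φ hr)
      -- Approximating the coefficients in `S` by images from `R` approximates the whole combination
      -- modulo the `k`-th power.
      have key : ∀ y ∈ Ideal.span (φ '' (a '' s)),
          ∃ r ∈ Ideal.span (a '' (s : Set S)), y - φ r ∈ maximalIdeal S ^ k := by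
        intro y hy
        induction hy using Submodule.span_induction with
        | mem y hy =>
          obtain ⟨r, hr, rfl⟩ := hy
          exact ⟨r, Ideal.subset_span hr, by simp⟩
        | zero => exact ⟨0, zero_mem _, by simp⟩
        | add x y _ _ hx hy =>
          obtain ⟨r, hr, hrx⟩ := hx
          obtain ⟨r', hr', hry⟩ := hy
          exact ⟨r + r', add_mem hr hr', by
            rw [map_add, add_sub_add_comm]; exact add_mem hrx hry⟩
        | smul c y _ hy =>
          obtain ⟨r, hr, hry⟩ := hy
          refine ⟨a c * r, Ideal.mul_mem_left _ _ hr, ?_⟩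
          have e : c • y - φ (a c * r) = c * (y - φ r) + φ r * (c - φ (a c)) := by
            rw [map_mul, smul_eq_mul]; ring
          rw [e]
          exact add_mem (Ideal.mul_mem_left _ _ hry) (Ideal.mul_mem_left _ _ (hak c))
      obtain ⟨r', hr', hrr⟩ := key _ hφr
      rw [← map_sub] at hrr
      rw [← add_sub_cancel r' r]
      exact Submodule.add_mem_sup hr' (hk _ hrr)
    rw [← Finset.coe_image] at h2
    refine (ringKrullDim_le_card_of_pow_le_span (s.image a) n ?_ h2).trans ?_
    · rw [Finset.coe_image]
      rintro _ ⟨x, hx, rfl⟩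
      intro hu
      have h3 : φ (a x) ∈ maximalIdeal S := by
        rw [← sub_sub_cancel x (φ (a x))]
        exact sub_mem (hsm hx) (Ideal.pow_le_self n.succ_ne_zero (han x))
      exact h3 (hu.map φ)
    · rw [hs]
      exact_mod_cast Finset.card_image_le
  · obtain ⟨s, n, hsm, hsn, hs⟩ := exists_finset_pow_le_span R
    have h1 := Ideal.map_mono (f := φ) hsn
    rw [Ideal.map_pow, hmap, Ideal.map_span, ← Finset.coe_image] at h1
    refine (ringKrullDim_le_card_of_pow_le_span (s.image φ) n ?_ h1).trans ?_
    · rw [Finset.coe_image]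
      rintro _ ⟨x, hx, rfl⟩
      rw [← hmap]
      exact Ideal.mem_map_of_mem φ (hsm hx)
    · rw [hs]
      exact_mod_cast Finset.card_image_le

/-- If an ideal of full dimension contains a finite intersection of ideals, then one of these has
full dimension. -/
theorem exists_ringKrullDim_quotient_eq {S ι : Type*} [CommRing S] [FiniteRingKrullDim S]
    (t : Finset ι) (J : ι → Ideal S) (I : Ideal S) (hI : t.inf J ≤ I)
    (h : ringKrullDim S = ringKrullDim (S ⧸ I)) :
    ∃ i ∈ t, ringKrullDim S = ringKrullDim (S ⧸ J i) := by
  rw [ringKrullDim_quotient] at h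
  have hne : Nonempty (PrimeSpectrum.zeroLocus (I : Set S)) := by
    rw [← Order.krullDim_ne_bot_iff, ← h]
    exact ringKrullDim_ne_bot
  have hfin : FiniteDimensionalOrder (PrimeSpectrum.zeroLocus (I : Set S)) := by
    rw [Order.finiteDimensionalOrder_iff_krullDim_ne_bot_and_top, ← h]
    exact ⟨ringKrullDim_ne_bot, ringKrullDim_ne_top⟩
  let c : LTSeries (PrimeSpectrum.zeroLocus (I : Set S)) := LTSeries.longestOf _
  have hc : ringKrullDim S = c.length := by
    rw [h, Order.krullDim_eq_length_of_finiteDimensionalOrder]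
  -- The smallest prime of a longest chain over `I` contains some `J i`, so the entire chain lies
  -- over that `J i`.
  obtain ⟨i, hi, hip⟩ := (Ideal.IsPrime.inf_le' (c.head).1.2).1 (hI.trans c.head.2)
  refine ⟨i, hi, le_antisymm ?_ (ringKrullDim_quotient_le _)⟩
  rw [hc, ringKrullDim_quotient]
  have hmem : ∀ p : PrimeSpectrum.zeroLocus (I : Set S), c.head ≤ p →
      p.1 ∈ PrimeSpectrum.zeroLocus (J i : Set S) := fun p hp => hip.trans hp
  let c' : LTSeries (PrimeSpectrum.zeroLocus (J i : Set S)) :=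
    { length := c.length
      toFun := fun j => ⟨(c j).1, hmem _ (c.head_le j)⟩
      step := fun j => c.step j }
  exact Order.LTSeries.length_le_krullDim c'

end Dimension

/-! ### The super-ring as a module over its even part; nilpotency of the odd part. -/

section EvenPart

variable {A : Type*} [Ring A] (𝒜 : ZMod 2 → AddSubgroup A) [GradedRing 𝒜]

variable {𝒜} in
theorem proj_of_mem {i : ZMod 2} {a : A} (ha : a ∈ 𝒜 i) : GradedRing.proj 𝒜 i a = a :=
  DirectSum.decompose_of_mem_same 𝒜 ha

variable {𝒜} in
theorem proj_of_mem_ne {i j : ZMod 2} {a : A} (ha : a ∈ 𝒜 i) (h : i ≠ j) :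
    GradedRing.proj 𝒜 j a = 0 :=
  DirectSum.decompose_of_mem_ne 𝒜 ha h

variable {𝒜} in
theorem odd_mul_odd_mem {a b : A} (ha : a ∈ 𝒜 1) (hb : b ∈ 𝒜 1) : a * b ∈ 𝒜 0 :=
  SetLike.mul_mem_graded ha hb

variable {𝒜} in
theorem even_mul_mem {i : ZMod 2} {a b : A} (ha : a ∈ 𝒜 0) (hb : b ∈ 𝒜 i) : a * b ∈ 𝒜 i := by
  simpa only [zero_add] using SetLike.mul_mem_graded ha hb

variable {𝒜} in
theorem mul_even_mem {i : ZMod 2} {a b : A} (ha : a ∈ 𝒜 i) (hb : b ∈ 𝒜 0) : a * b ∈ 𝒜 i := by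
  simpa only [add_zero] using SetLike.mul_mem_graded ha hb

theorem proj_zero_mul (a b : A) : GradedRing.proj 𝒜 0 (a * b) =
    GradedRing.proj 𝒜 0 a * GradedRing.proj 𝒜 0 b +
      GradedRing.proj 𝒜 1 a * GradedRing.proj 𝒜 1 b := by
  conv_lhs => rw [← proj_add_proj 𝒜 a, ← proj_add_proj 𝒜 b, add_mul, mul_add, mul_add]
  simp only [map_add]
  rw [proj_of_mem (even_mul_mem (proj_mem 𝒜 0 a) (proj_mem 𝒜 0 b)),
    proj_of_mem (odd_mul_odd_mem (proj_mem 𝒜 1 a) (proj_mem 𝒜 1 b)),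
    proj_of_mem_ne (even_mul_mem (proj_mem 𝒜 0 a) (proj_mem 𝒜 1 b)) (by decide),
    proj_of_mem_ne (mul_even_mem (proj_mem 𝒜 1 a) (proj_mem 𝒜 0 b)) (by decide),
    add_zero, zero_add]

theorem even_coe_sub (r s : evenPart 𝒜) : ((r - s : evenPart 𝒜) : A) = r - s := rfl

variable [IsSuperCommutative 𝒜]

/-- A super-commutative super-ring is an algebra over its even part. -/
instance evenPart.instAlgebra : Algebra (evenPart 𝒜) A where
  algebraMap := (evenPart 𝒜).subtype
  commutes' r a := even_comm (𝒜 := 𝒜) r.2 a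
  smul_def' _ _ := rfl

theorem even_smul_def (r : evenPart 𝒜) (a : A) : r • a = (r : A) * a := rfl

theorem proj_smul (i : ZMod 2) (r : evenPart 𝒜) (a : A) :
    GradedRing.proj 𝒜 i (r • a) = r • GradedRing.proj 𝒜 i a := by
  rw [even_smul_def, even_smul_def]
  have h : ∀ j, (r : A) * GradedRing.proj 𝒜 j a ∈ 𝒜 j := fun j =>
    even_mul_mem r.2 (proj_mem 𝒜 j a)
  conv_lhs => rw [← proj_add_proj 𝒜 a, mul_add, map_add]
  rcases zmod_two_cases i with rfl | rfl
  · rw [proj_of_mem (h 0), proj_of_mem_ne (h 1) (by decide), add_zero]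
  · rw [proj_of_mem (h 1), proj_of_mem_ne (h 0) (by decide), zero_add]

/-- The projection to a homogeneous component, as a linear map over the even part. -/
def projLinear (i : ZMod 2) : A →ₗ[evenPart 𝒜] A where
  toFun := GradedRing.proj 𝒜 i
  map_add' := map_add _
  map_smul' r a := proj_smul 𝒜 i r a

/-- The even component of an element, as a linear map over the even part. -/
def evenProj : A →ₗ[evenPart 𝒜] evenPart 𝒜 where
  toFun a := ⟨GradedRing.proj 𝒜 0 a, proj_mem 𝒜 0 a⟩
  map_add' a b := Subtype.ext (map_add _ a b)
  map_smul' r a := Subtype.ext (proj_smul 𝒜 0 r a)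

theorem evenProj_coe (r : evenPart 𝒜) : evenProj 𝒜 (r : A) = r :=
  Subtype.ext (proj_of_mem r.2)

/-- A homogeneous component, as a submodule over the even part. -/
def gradedPart (i : ZMod 2) : Submodule (evenPart 𝒜) A where
  carrier := 𝒜 i
  add_mem' := (𝒜 i).add_mem
  zero_mem' := (𝒜 i).zero_mem
  smul_mem' r _ ha := even_mul_mem r.2 ha

theorem mem_gradedPart {i : ZMod 2} {a : A} : a ∈ gradedPart 𝒜 i ↔ a ∈ 𝒜 i := Iff.rfl

theorem gradedPart_sup : gradedPart 𝒜 0 ⊔ gradedPart 𝒜 1 = ⊤ := by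
  refine eq_top_iff.2 fun a _ => ?_
  rw [← proj_add_proj 𝒜 a]
  exact Submodule.add_mem_sup (proj_mem 𝒜 0 a) (proj_mem 𝒜 1 a)

theorem isNoetherianSuper_of_isNoetherian [IsNoetherian (evenPart 𝒜) A] :
    IsNoetherianSuper 𝒜 := by
  have h : WellFoundedGT (Submodule (evenPart 𝒜) A) := isNoetherian_iff'.1 inferInstance
  let g : HomogeneousIdeal 𝒜 → Submodule (evenPart 𝒜) A := fun I =>
    { carrier := I.toIdeal
      add_mem' := I.toIdeal.add_mem
      zero_mem' := I.toIdeal.zero_mem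
      smul_mem' := fun r _ ha => I.toIdeal.mul_mem_left r ha }
  have hg : StrictMono g := strictMono_of_le_iff_le fun I J => Iff.rfl
  exact hg.wellFoundedGT

/-- Odd coefficients move `N` into the other degree, so only even coefficients contribute in degree
`i`. Thus `N` is recovered from the super-ideal it generates, and chains of submodules embed into
chains of super-ideals. -/
theorem proj_mem_of_mem_span {i : ZMod 2} {N : Submodule (evenPart 𝒜) A}
    (hN : N ≤ gradedPart 𝒜 i) {x : A} (hx : x ∈ Ideal.span (N : Set A)) :
    GradedRing.proj 𝒜 i x ∈ N := by
  -- Allowing all multiples `c * x` makes the scalar step of the induction immediate.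
  suffices h : ∀ c, GradedRing.proj 𝒜 i (c * x) ∈ N by simpa only [one_mul] using h 1
  induction hx using Submodule.span_induction with
  | mem x hx =>
    intro c
    have h0 : GradedRing.proj 𝒜 0 c * x ∈ N :=
      N.smul_mem (⟨_, proj_mem 𝒜 0 c⟩ : evenPart 𝒜) hx
    have h1 : GradedRing.proj 𝒜 1 c * x ∈ 𝒜 (1 + i) :=
      SetLike.mul_mem_graded (proj_mem 𝒜 1 c) (hN hx)
    rw [← proj_add_proj 𝒜 c, add_mul, map_add, proj_of_mem (hN h0), proj_of_mem_ne h1, add_zero]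
    · exact h0
    · simp
  | zero => intro c; rw [mul_zero, map_zero]; exact zero_mem _
  | add x y _ _ hx hy => intro c; rw [mul_add, map_add]; exact add_mem (hx c) (hy c)
  | smul d x _ hx => intro c; rw [smul_eq_mul, ← mul_assoc]; exact hx _

variable {𝒜} in
theorem isNoetherian_gradedPart (hA : IsNoetherianSuper 𝒜) (i : ZMod 2) :
    IsNoetherian (evenPart 𝒜) (gradedPart 𝒜 i) := by
  have hA' : WellFoundedGT (HomogeneousIdeal 𝒜) := hA
  let g : Submodule (evenPart 𝒜) (gradedPart 𝒜 i) → HomogeneousIdeal 𝒜 := fun N =>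
    ⟨Ideal.span ((N.map (gradedPart 𝒜 i).subtype : Submodule (evenPart 𝒜) A) : Set A),
      Ideal.homogeneous_span 𝒜 _ (by rintro _ ⟨x, -, rfl⟩; exact ⟨i, x.2⟩)⟩
  have hg : StrictMono g := by
    refine strictMono_of_le_iff_le fun N N' =>
      ⟨fun h => Ideal.span_mono (Submodule.map_mono h), fun h x hx => ?_⟩
    have h1 : (x : A) ∈ Ideal.span
        ((N'.map (gradedPart 𝒜 i).subtype : Submodule (evenPart 𝒜) A) : Set A) :=
      h (Ideal.subset_span ⟨x, hx, rfl⟩)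
    have h2 := proj_mem_of_mem_span 𝒜 (i := i) (Submodule.map_subtype_le _ N') h1
    rw [proj_of_mem x.2] at h2
    obtain ⟨y, hy, hyx⟩ := h2
    rwa [← Subtype.ext hyx]
  exact isNoetherian_iff'.2 hg.wellFoundedGT

variable {𝒜} in
theorem isNoetherian_evenPart (hA : IsNoetherianSuper 𝒜) : IsNoetherian (evenPart 𝒜) A := by
  have h0 := isNoetherian_gradedPart hA 0
  have h1 := isNoetherian_gradedPart hA 1
  rw [← isNoetherian_top_iff, ← gradedPart_sup]
  infer_instance

theorem isNoetherianRing_evenPart [IsNoetherian (evenPart 𝒜) A] :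
    IsNoetherianRing (evenPart 𝒜) :=
  isNoetherian_of_injective (Algebra.linearMap (evenPart 𝒜) A) Subtype.val_injective

/-- The product of odd elements, as an alternating map over the even part. -/
noncomputable def oddProd (s : ℕ) : gradedPart 𝒜 1 [⋀^Fin s]→ₗ[evenPart 𝒜] A :=
  (ExteriorAlgebra.lift (evenPart 𝒜) ⟨(gradedPart 𝒜 1).subtype, fun y =>
    IsSuperCommutative.odd_mul_self (𝒜 := 𝒜) (y : A) y.2⟩).toLinearMap.compAlternatingMap
      (ExteriorAlgebra.ιMulti (evenPart 𝒜) s)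

theorem oddProd_apply {s : ℕ} (y : Fin s → gradedPart 𝒜 1) :
    oddProd 𝒜 s y = (List.ofFn fun i => (y i : A)).prod := by
  simp only [oddProd, LinearMap.compAlternatingMap_apply, ExteriorAlgebra.ιMulti_apply,
    AlgHom.toLinearMap_apply, map_list_prod, List.map_ofFn]
  congr 2
  funext i
  exact ExteriorAlgebra.lift_ι_apply _ _ _ _

/-- In a product of more odd generators than there are generators, one repeats, and the product is
alternating. -/
theorem exists_gradedPart_pow_eq_bot [IsNoetherian (evenPart 𝒜) A] :
    ∃ k, gradedPart 𝒜 1 ^ k = ⊥ := by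
  obtain ⟨Z, hZ⟩ := IsNoetherian.noetherian (gradedPart 𝒜 1)
  refine ⟨Z.card + 1, ?_⟩
  rw [← hZ, Submodule.span_pow, Submodule.span_eq_bot]
  intro x hx
  obtain ⟨f, rfl⟩ := Set.mem_pow.1 hx
  have hf : ∀ i, (f i : A) ∈ gradedPart 𝒜 1 := fun i => by
    rw [← hZ]; exact Submodule.subset_span (f i).2
  have h := oddProd_apply 𝒜 (fun i => (⟨f i, hf i⟩ : gradedPart 𝒜 1))
  rw [← h]
  refine AlternatingMap.map_eq_zero_of_not_injective _ _ fun hinj => ?_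
  have hinj' : Function.Injective fun i => (⟨f i, (f i).2⟩ : Z) := fun i j hij =>
    hinj (Subtype.ext (congrArg (fun z : Z => (z : A)) hij))
  have := Fintype.card_le_of_injective _ hinj'
  simp at this

end EvenPart

/-! ### Locality of the even part, and comparison of the two adic topologies. -/

section Local

variable {A : Type*} [Ring A] {𝒜 : ZMod 2 → AddSubgroup A} [GradedRing 𝒜] [IsSuperCommutative 𝒜]

/-- The even part of a super-ideal. -/
def evenIdeal (m : HomogeneousIdeal 𝒜) : Ideal (evenPart 𝒜) :=
  m.toIdeal.comap (evenPart 𝒜).subtype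

theorem mem_evenIdeal {m : HomogeneousIdeal 𝒜} {r : evenPart 𝒜} :
    r ∈ evenIdeal m ↔ (r : A) ∈ m.toIdeal := Iff.rfl

/-- The product squares to zero by anticommutation. This is what makes taking even components
multiplicative modulo a prime. -/
theorem odd_mul_odd_mem_prime (n : Ideal (evenPart 𝒜)) [n.IsPrime] {a b : A} (ha : a ∈ 𝒜 1)
    (hb : b ∈ 𝒜 1) : (⟨a * b, odd_mul_odd_mem ha hb⟩ : evenPart 𝒜) ∈ n := by
  refine Ideal.IsPrime.mem_of_pow_mem ‹_› 2 ?_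
  have h : (⟨a * b, odd_mul_odd_mem ha hb⟩ : evenPart 𝒜) ^ 2 = 0 := by
    refine Subtype.ext ?_
    change (a * b) ^ 2 = 0
    rw [sq, mul_assoc, ← mul_assoc b a b, odd_anticomm hb ha, neg_mul, mul_assoc a b b,
      IsSuperCommutative.odd_mul_self b hb]
    simp
  rw [h]
  exact zero_mem _

/-- The homomorphism from a super-ring to a quotient of its even part by a prime ideal. -/
def toQuotientEven (n : Ideal (evenPart 𝒜)) [n.IsPrime] : A →+* evenPart 𝒜 ⧸ n where
  toFun a := Ideal.Quotient.mk n (evenProj 𝒜 a)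
  map_one' := by
    rw [← map_one (Ideal.Quotient.mk n)]
    exact congrArg _ (evenProj_coe 𝒜 1)
  map_mul' a b := by
    rw [← map_mul, Ideal.Quotient.eq]
    have h : evenProj 𝒜 (a * b) - evenProj 𝒜 a * evenProj 𝒜 b =
        ⟨_, odd_mul_odd_mem (proj_mem 𝒜 1 a) (proj_mem 𝒜 1 b)⟩ := by
      refine Subtype.ext ?_
      change GradedRing.proj 𝒜 0 (a * b) - GradedRing.proj 𝒜 0 a * GradedRing.proj 𝒜 0 b = _
      rw [proj_zero_mul, add_sub_cancel_left]
    rw [h]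
    exact odd_mul_odd_mem_prime n (proj_mem 𝒜 1 a) (proj_mem 𝒜 1 b)
  map_zero' := by rw [map_zero, map_zero]
  map_add' a b := by rw [map_add, map_add]

/-- The super-ideal `𝔫 ⊕ A₁` attached to a prime ideal `𝔫` of `A₀`. -/
def superIdealOfPrime (n : Ideal (evenPart 𝒜)) [n.IsPrime] : HomogeneousIdeal 𝒜 where
  toSubmodule := RingHom.ker (toQuotientEven n)
  is_homogeneous' := by
    intro i a ha
    change Ideal.Quotient.mk n (evenProj 𝒜 a) = 0 at ha
    change Ideal.Quotient.mk n (evenProj 𝒜 (GradedRing.proj 𝒜 i a)) = 0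
    rcases zmod_two_cases i with rfl | rfl
    · rw [show evenProj 𝒜 (GradedRing.proj 𝒜 0 a) = evenProj 𝒜 a from
        Subtype.ext (proj_of_mem (proj_mem 𝒜 0 a)), ha]
    · rw [show evenProj 𝒜 (GradedRing.proj 𝒜 1 a) = 0 from
        Subtype.ext (proj_of_mem_ne (proj_mem 𝒜 1 a) (by decide)), map_zero]

theorem isMaximalSuperIdeal_superIdealOfPrime (n : Ideal (evenPart 𝒜)) [n.IsMaximal] :
    IsMaximalSuperIdeal (superIdealOfPrime n) := by
  have hs : Function.Surjective (toQuotientEven n) := by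
    intro x
    obtain ⟨r, rfl⟩ := Ideal.Quotient.mk_surjective x
    exact ⟨r, congrArg _ (evenProj_coe 𝒜 r)⟩
  exact (RingHom.quotientKerEquivOfSurjective hs).toMulEquiv.isField
    ((Ideal.Quotient.maximal_ideal_iff_isField_quotient n).1 inferInstance)

theorem one_notMem_of_isMaximal {m : HomogeneousIdeal 𝒜} (hm : IsMaximalSuperIdeal m) :
    (1 : A) ∉ m.toIdeal := by
  intro h
  obtain ⟨x, y, hxy⟩ := hm.exists_pair_ne
  apply hxy
  have := Ideal.Quotient.subsingleton_iff.2 ((Ideal.eq_top_iff_one _).2 h)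
  exact Subsingleton.elim _ _

/-- A nonunit lies in a maximal ideal `𝔫` of `A₀`; then `𝔫 ⊕ A₁` is a maximal super-ideal and must
be `𝔪`. -/
theorem isLocalRing_evenPart {m : HomogeneousIdeal 𝒜} (hm : IsLocalWith 𝒜 m) :
    ∃ _ : IsLocalRing (evenPart 𝒜), IsLocalRing.maximalIdeal (evenPart 𝒜) = evenIdeal m := by
  have h1 := one_notMem_of_isMaximal hm.1
  have hnu : ∀ r : evenPart 𝒜, r ∈ nonunits _ ↔ r ∈ evenIdeal m := by
    intro r
    constructor
    · intro hr
      obtain ⟨n, hn, hrn⟩ := exists_max_ideal_of_mem_nonunits hr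
      rw [mem_evenIdeal, ← hm.2 _ (isMaximalSuperIdeal_superIdealOfPrime n)]
      change Ideal.Quotient.mk n (evenProj 𝒜 r) = 0
      rwa [evenProj_coe, Ideal.Quotient.eq_zero_iff_mem]
    · intro hr hu
      exact h1 ((Ideal.eq_top_iff_one _).1 (Ideal.eq_top_of_isUnit_mem _ hr (hu.map (evenPart 𝒜).subtype)))
  have : Nontrivial (evenPart 𝒜) := by
    refine ⟨0, 1, fun h => h1 ?_⟩
    have h' : (0 : A) = 1 := congrArg Subtype.val h
    rw [← h']
    exact zero_mem _
  refine ⟨IsLocalRing.of_nonunits_add fun a b ha hb => ?_, Ideal.ext hnu⟩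
  rw [hnu] at *
  exact add_mem ha hb

/-- Since `𝔪 ⊆ 𝔪₀A + A₁`, the `n`-th power of `𝔪` lies in `𝔪₀ⁿA + A₁A`. Raising this to a power `b`
with `A₁ᵇ = 0` removes the second summand. -/
theorem pow_mem_smul_top {m : HomogeneousIdeal 𝒜} [IsNoetherian (evenPart 𝒜) A]
    (n : ℕ) : ∃ k, ∀ a ∈ m.toIdeal ^ k,
      a ∈ evenIdeal m ^ n • (⊤ : Submodule (evenPart 𝒜) A) := by
  obtain ⟨b, hb⟩ := exists_gradedPart_pow_eq_bot 𝒜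
  set V := gradedPart 𝒜 1
  set I := evenIdeal m
  let T : Submodule (evenPart 𝒜) A := ⊤
  let P : ℕ → Submodule (evenPart 𝒜) A := fun n => I ^ n • T
  let M : Submodule (evenPart 𝒜) A := m.toIdeal.restrictScalars (evenPart 𝒜)
  have hTT : T = 1 ⊔ V := by
    refine le_antisymm (fun a _ => ?_) le_top
    rw [← proj_add_proj 𝒜 a]
    exact Submodule.add_mem_sup
      (Submodule.mem_one.2 ⟨⟨_, proj_mem 𝒜 0 a⟩, rfl⟩) (proj_mem 𝒜 1 a)
  have hTV : T * V = V * T := by rw [hTT, Submodule.sup_mul, Submodule.mul_sup, one_mul, mul_one]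
  have hPT : ∀ n K, P n * K ≤ P n := by
    intro n K
    rw [Submodule.mul_le]
    intro x hx y _
    induction hx using Submodule.smul_induction_on' with
    | smul r hr z _ =>
      rw [smul_mul_assoc]
      exact Submodule.smul_mem_smul hr trivial
    | add x _ y _ hx hy => rw [add_mul]; exact add_mem hx hy
  have hTP : ∀ n K, K * P n ≤ P n := by
    intro n K
    rw [Submodule.mul_le]
    intro y _ x hx
    induction hx using Submodule.smul_induction_on' with
    | smul r hr z _ =>
      rw [mul_smul_comm]
      exact Submodule.smul_mem_smul hr trivial
    | add x _ y _ hx hy => rw [mul_add]; exact add_mem hx hy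
  have hPP : ∀ n, P n * P 1 ≤ P (n + 1) := by
    intro n
    rw [Submodule.mul_le]
    intro x hx y hy
    induction hx using Submodule.smul_induction_on' with
    | smul r hr z _ =>
      rw [smul_mul_assoc]
      have := hTP 1 T (Submodule.mul_mem_mul (m := z) trivial hy)
      change _ ∈ I ^ (n + 1) • T
      rw [pow_add, mul_smul]
      exact Submodule.smul_mem_smul hr this
    | add x _ y _ hx hy => rw [add_mul]; exact add_mem hx hy
  have hM : M ≤ P 1 ⊔ V := by
    intro a ha
    rw [← proj_add_proj 𝒜 a]
    refine Submodule.add_mem_sup ?_ (proj_mem 𝒜 1 a)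
    have h0 : (⟨_, proj_mem 𝒜 0 a⟩ : evenPart 𝒜) ∈ I ^ 1 := by
      rw [pow_one]; exact m.isHomogeneous 0 ha
    have := Submodule.smul_mem_smul h0 (show (1 : A) ∈ T from trivial)
    rwa [even_smul_def, mul_one] at this
  have hMn : ∀ n, M ^ n ≤ P n ⊔ V * T := by
    intro n
    induction n with
    | zero => intro a _; exact Submodule.mem_sup_left (by simp [P, T])
    | succ n ih =>
      rw [pow_succ]
      refine (mul_le_mul' ih hM).trans ?_
      rw [Submodule.sup_mul, Submodule.mul_sup, Submodule.mul_sup]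
      refine sup_le (sup_le ((hPP n).trans le_sup_left) ?_) (sup_le ?_ ?_)
      · refine le_trans ?_ le_sup_right
        rw [← hTV]
        exact mul_le_mul' le_top le_rfl
      · rw [mul_assoc]; exact (mul_le_mul' le_rfl le_top).trans le_sup_right
      · rw [mul_assoc]; exact (mul_le_mul' le_rfl le_top).trans le_sup_right
  have hMb : ∀ b, (P n ⊔ V * T) ^ b ≤ P n ⊔ V ^ b * T := by
    intro b
    induction b with
    | zero => rw [pow_zero, pow_zero, one_mul]; exact le_top.trans le_sup_right
    | succ b ih =>
      rw [pow_succ]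
      refine (mul_le_mul' ih le_rfl).trans ?_
      rw [Submodule.sup_mul]
      refine sup_le ((hPT n _).trans le_sup_left) ?_
      rw [Submodule.mul_sup]
      refine sup_le ((hTP n _).trans le_sup_left) (le_trans ?_ le_sup_right)
      rw [mul_assoc, ← mul_assoc T V, hTV, mul_assoc V, ← mul_assoc, ← pow_succ]
      exact mul_le_mul' le_rfl le_top
  -- The exponent must be positive: the zeroth ideal power is all of `A`, whereas `M ^ 0` is only
  -- the image of `A₀`. Hence also the `+ 1` in the final witness.
  have hpow : ∀ k, ∀ a ∈ m.toIdeal ^ (k + 1), a ∈ M ^ (k + 1) := by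
    intro k
    induction k with
    | zero =>
      intro a ha
      rw [Submodule.pow_succ] at ha
      rw [zero_add, pow_one]
      refine Submodule.smul_induction_on (p := fun a => a ∈ M) ha ?_ fun x y => add_mem
      exact fun r _ x hx => m.toIdeal.mul_mem_left r hx
    | succ k ih =>
      intro a ha
      rw [Submodule.pow_succ] at ha
      refine Submodule.smul_induction_on (p := fun a => a ∈ M ^ (k + 1 + 1)) ha ?_
        fun x y => add_mem
      intro r hr x hx
      rw [pow_succ]
      exact Submodule.mul_mem_mul (ih r hr) hx
  have hle : M ^ (n * b) ≤ P n := by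
    rw [pow_mul]
    refine ((pow_le_pow_left' (hMn n) b).trans (hMb b)).trans ?_
    rw [hb, Submodule.bot_mul, sup_bot_eq]
  refine ⟨n * b + 1, fun a ha => ?_⟩
  have h1 := hpow _ a ha
  rw [pow_succ] at h1
  exact hPT n M (mul_le_mul' hle le_rfl h1)

end Local

/-! ### The completion and its even part as filtered completions over `A₀`. -/

section CompletionFiltration

variable {A : Type*} [Ring A] {𝒜 : ZMod 2 → AddSubgroup A} [GradedRing 𝒜] [IsSuperCommutative 𝒜]
  (m : HomogeneousIdeal 𝒜)

/-- The component of index `k` of an element of the completion. -/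
def Completion.eval (k : ℕ) : Completion m →+* A ⧸ m.toIdeal ^ k :=
  (Pi.evalRingHom (fun n : ℕ => A ⧸ m.toIdeal ^ n) k).comp (completionSubring m).subtype

variable {m} in
theorem Completion.ext_eval {x y : Completion m}
    (h : ∀ k, Completion.eval m k x = Completion.eval m k y) : x = y :=
  Subtype.ext (funext h)

theorem Completion.factor_eval {j k : ℕ} (h : j ≤ k) (x : Completion m) :
    Ideal.Quotient.factor (Ideal.pow_le_pow_right h) (Completion.eval m k x) =
      Completion.eval m j x :=
  x.2 j k h

/-- The canonical homomorphism from a super-ring to its completion. -/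
def toCompletion : A →+* Completion m :=
  (RingHom.codRestrict (RingHom.pi fun n : ℕ => Ideal.Quotient.mk (m.toIdeal ^ n))
    (completionSubring m) fun a j k h => by simp)

theorem toCompletion_mem {i : ZMod 2} {a : A} (ha : a ∈ 𝒜 i) :
    toCompletion m a ∈ completionGrading m i := fun _ => ⟨a, ha, rfl⟩

/-- The canonical homomorphism from the even part of a super-ring to the even part of its
completion. -/
noncomputable def evenToCompletion : evenPart 𝒜 →+* evenPart (completionGrading m) :=
  ((toCompletion m).comp (evenPart 𝒜).subtype).codRestrict _ fun r => toCompletion_mem m r.2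

theorem evenToCompletion_coe (r : evenPart 𝒜) :
    (evenToCompletion m r : Completion m) = toCompletion m r := rfl

/-- The canonical map to the completion, as a semilinear map over the even parts. -/
noncomputable def toCompletionLinear : A →ₛₗ[evenToCompletion m] Completion m where
  toFun := toCompletion m
  map_add' := map_add _
  map_smul' r a := map_mul (toCompletion m) (r : A) a

/-- The canonical map between even parts, as a semilinear map over itself. -/
noncomputable def evenToCompletionLinear :
    evenPart 𝒜 →ₛₗ[evenToCompletion m] evenPart (completionGrading m) where
  toFun := evenToCompletion m
  map_add' := map_add _
  map_smul' := map_mul (evenToCompletion m)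

/-- The filtration of the even part of the completion by the closures of the powers of the
maximal ideal of `A₀`. -/
def evenFiltration (n : ℕ) : Ideal (evenPart (completionGrading m)) where
  carrier := {s | ∀ k, ∃ r ∈ evenIdeal m ^ n,
    Ideal.Quotient.mk (m.toIdeal ^ k) (r : A) = Completion.eval m k s}
  add_mem' := by
    intro s t hs ht k
    obtain ⟨a, ha, has⟩ := hs k
    obtain ⟨b, hb, hbt⟩ := ht k
    exact ⟨a + b, add_mem ha hb, by
      rw [Subring.coe_add, Subring.coe_add, map_add, map_add, has, hbt]⟩
  zero_mem' := fun k => ⟨0, zero_mem _, by simp⟩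
  smul_mem' := by
    intro c s hs k
    obtain ⟨b, hb, hbs⟩ := hs k
    obtain ⟨a, ha, hac⟩ := c.2 k
    refine ⟨⟨a, ha⟩ * b, Ideal.mul_mem_left _ _ hb, ?_⟩
    rw [smul_eq_mul, Subring.coe_mul, Subring.coe_mul, map_mul, map_mul, hbs]
    exact congrArg (· * _) hac

/-- The filtration of the completion by the closures of the submodules `𝔪₀ⁿ A`. -/
def completionFiltration (n : ℕ) :
    Submodule (evenPart (completionGrading m)) (Completion m) where
  carrier := {x | ∀ k, ∃ a ∈ evenIdeal m ^ n • (⊤ : Submodule (evenPart 𝒜) A),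
    Ideal.Quotient.mk (m.toIdeal ^ k) a = Completion.eval m k x}
  add_mem' := by
    intro s t hs ht k
    obtain ⟨a, ha, has⟩ := hs k
    obtain ⟨b, hb, hbt⟩ := ht k
    exact ⟨a + b, add_mem ha hb, by rw [map_add, map_add, has, hbt]⟩
  zero_mem' := fun k => ⟨0, zero_mem _, by simp⟩
  smul_mem' := by
    intro c s hs k
    obtain ⟨b, hb, hbs⟩ := hs k
    obtain ⟨a, ha, hac⟩ := c.2 k
    refine ⟨(⟨a, ha⟩ : evenPart 𝒜) • b, Submodule.smul_mem _ _ hb, ?_⟩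
    rw [even_smul_def, even_smul_def, map_mul, map_mul, hbs]
    exact congrArg (· * _) hac

variable {m}

theorem coe_mem_pow {n : ℕ} {r : evenPart 𝒜} (hr : r ∈ evenIdeal m ^ n) :
    (r : A) ∈ m.toIdeal ^ n := by
  induction n generalizing r with
  | zero => rw [Submodule.pow_zero, Ideal.one_eq_top]; trivial
  | succ n ih =>
    rw [pow_succ] at hr
    rw [Submodule.pow_succ]
    refine Submodule.mul_induction_on
      (C := fun r : evenPart 𝒜 => (r : A) ∈ m.toIdeal ^ n * m.toIdeal) hr ?_ ?_
    · exact fun x hx y hy => Ideal.mul_mem_mul (ih hx) hy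
    · exact fun x y hx hy => add_mem hx hy

theorem mem_pow_of_mem_smul_top {n : ℕ} {a : A}
    (ha : a ∈ evenIdeal m ^ n • (⊤ : Submodule (evenPart 𝒜) A)) : a ∈ m.toIdeal ^ n := by
  refine Submodule.smul_induction_on (p := fun a => a ∈ m.toIdeal ^ n) ha ?_ fun x y => add_mem
  intro r hr x _
  rw [even_smul_def, even_comm r.2]
  exact Ideal.mul_mem_left _ _ (coe_mem_pow hr)

theorem coe_mem_smul_top {n : ℕ} {r : evenPart 𝒜} (hr : r ∈ evenIdeal m ^ n) :
    (r : A) ∈ evenIdeal m ^ n • (⊤ : Submodule (evenPart 𝒜) A) := by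
  have := Submodule.smul_mem_smul hr (show (1 : A) ∈ (⊤ : Submodule (evenPart 𝒜) A) from trivial)
  rwa [even_smul_def, mul_one] at this

/-- The even component is an `A₀`-linear retraction of `A` onto `A₀`. -/
theorem mem_pow_of_coe_mem_smul_top {n : ℕ} {r : evenPart 𝒜}
    (hr : (r : A) ∈ evenIdeal m ^ n • (⊤ : Submodule (evenPart 𝒜) A)) : r ∈ evenIdeal m ^ n := by
  rw [← evenProj_coe 𝒜 r]
  refine Submodule.smul_induction_on (p := fun a => evenProj 𝒜 a ∈ evenIdeal m ^ n) hr ?_ ?_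
  · intro c hc x _
    rw [map_smul, smul_eq_mul]
    exact Ideal.mul_mem_right _ _ hc
  · intro x y hx hy
    rw [map_add]
    exact add_mem hx hy

theorem eval_eq_zero_of_mem {n k : ℕ} (hkn : k ≤ n) {x : Completion m}
    (hx : x ∈ completionFiltration m n) : Completion.eval m k x = 0 := by
  obtain ⟨a, ha, hax⟩ := hx k
  rw [← hax, Ideal.Quotient.eq_zero_iff_mem]
  exact Ideal.pow_le_pow_right hkn (mem_pow_of_mem_smul_top ha)

theorem coe_mem_completionFiltration {n : ℕ} {s : evenPart (completionGrading m)}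
    (hs : s ∈ evenFiltration m n) : (s : Completion m) ∈ completionFiltration m n := by
  intro k
  obtain ⟨r, hr, hrs⟩ := hs k
  exact ⟨r, coe_mem_smul_top hr, hrs⟩

theorem antitone_evenFiltration : Antitone (evenFiltration m) := by
  intro i j hij s hs k
  obtain ⟨r, hr, hrs⟩ := hs k
  exact ⟨r, Ideal.pow_le_pow_right hij hr, hrs⟩

/-- Terms of index at least `k` vanish in `A / 𝔪ᵏ`, so the limit has as its `k`-th component that of
the `k`-th partial sum. -/
theorem exists_sub_sum_mem (s : ℕ → evenPart (completionGrading m))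
    (hs : ∀ n, s n ∈ evenFiltration m n) :
    ∃ t, ∀ n, t - ∑ i ∈ Finset.range n, s i ∈ evenFiltration m n := by
  let σ : ℕ → evenPart (completionGrading m) := fun n => ∑ i ∈ Finset.range n, s i
  have hσ : ∀ {j k}, j ≤ k → σ k - σ j ∈ evenFiltration m j := by
    intro j k hjk
    rw [← Finset.sum_Ico_eq_sub _ hjk]
    exact sum_mem fun i hi => antitone_evenFiltration (Finset.mem_Ico.1 hi).1 (hs i)
  have hev : ∀ {j k}, j ≤ k → Completion.eval m j (σ k) = Completion.eval m j (σ j) := by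
    intro j k hjk
    rw [← sub_eq_zero, ← map_sub, ← even_coe_sub]
    exact eval_eq_zero_of_mem le_rfl (coe_mem_completionFiltration (hσ hjk))
  let t : Completion m := ⟨fun k => Completion.eval m k (σ k), fun j k hjk => by
    exact (Completion.factor_eval m hjk _).trans (hev hjk)⟩
  have ht : ∀ k, Completion.eval m k t = Completion.eval m k (σ k) := fun k => rfl
  refine ⟨⟨t, fun k => (σ k).2 k⟩, fun n k => ?_⟩
  obtain ⟨r, hr, hrs⟩ := hσ (le_max_left n k) k
  refine ⟨r, hr, hrs.trans ?_⟩
  rw [even_coe_sub, even_coe_sub, map_sub, map_sub, hev (le_max_right n k), ← ht]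

theorem evenFiltration_smul_mem {k l : ℕ} {s : evenPart (completionGrading m)} {x : Completion m}
    (hs : s ∈ evenFiltration m k) (hx : x ∈ completionFiltration m l) :
    s • x ∈ completionFiltration m (k + l) := by
  intro j
  obtain ⟨r, hr, hrs⟩ := hs j
  obtain ⟨a, ha, hax⟩ := hx j
  refine ⟨r • a, ?_, ?_⟩
  · rw [pow_add, mul_smul]
    exact Submodule.smul_mem_smul hr ha
  · rw [even_smul_def, even_smul_def, map_mul, map_mul, hrs, hax]

theorem evenFiltration_mul_mem {k l : ℕ} {s x : evenPart (completionGrading m)}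
    (hs : s ∈ evenFiltration m k) (hx : x ∈ evenFiltration m l) :
    s • x ∈ evenFiltration m (k + l) := by
  intro j
  obtain ⟨r, hr, hrs⟩ := hs j
  obtain ⟨a, ha, hax⟩ := hx j
  refine ⟨r * a, ?_, ?_⟩
  · rw [pow_add]
    exact Ideal.mul_mem_mul hr ha
  · rw [smul_eq_mul, Subring.coe_mul, Subring.coe_mul, map_mul, map_mul, hrs, hax]

variable (m)

theorem isFilteredCompletion_completion [IsNoetherian (evenPart 𝒜) A] :
    IsFilteredCompletion (evenIdeal m) (evenToCompletion m) (toCompletionLinear m)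
      (evenFiltration m) (completionFiltration m) where
  complete := exists_sub_sum_mem
  smul_mem := evenFiltration_smul_mem
  antitone := by
    intro i j hij s hs k
    obtain ⟨r, hr, hrs⟩ := hs k
    exact ⟨r, Submodule.smul_mono_left (Ideal.pow_le_pow_right hij) hr, hrs⟩
  separated x hx := Completion.ext_eval fun k => by
    rw [eval_eq_zero_of_mem le_rfl (hx k), map_zero]
  zero_eq := by
    refine eq_top_iff.2 fun x _ k => ?_
    obtain ⟨a, ha⟩ := Ideal.Quotient.mk_surjective (Completion.eval m k x)
    exact ⟨a, by simp, ha⟩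
  map_mem_ideal hr _ := ⟨_, hr, rfl⟩
  map_mem ha _ := ⟨_, ha, rfl⟩
  exists_approx := by
    intro n x hx
    -- A representative `a` at level `N` works at every level, because representatives compatible
    -- with it differ from it by elements of `𝔪ᴺ ⊆ 𝔪₀ⁿ⁺¹A`.
    obtain ⟨N, hN⟩ := pow_mem_smul_top (m := m) (n + 1)
    obtain ⟨a, ha, hax⟩ := hx N
    refine ⟨a, ha, fun k => ?_⟩
    obtain ⟨b, hb, hbx⟩ := hx (max k N)
    refine ⟨b - a, hN _ ?_, ?_⟩
    · rw [← Ideal.Quotient.eq, hax, ← Completion.factor_eval m (le_max_right k N), ← hbx,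
        Ideal.Quotient.factor_mk]
    · rw [map_sub, map_sub, ← Completion.factor_eval m (le_max_left k N) x, ← hbx,
        Ideal.Quotient.factor_mk]
      rfl

theorem isFilteredCompletion_even [IsNoetherian (evenPart 𝒜) A] :
    IsFilteredCompletion (evenIdeal m) (evenToCompletion m) (evenToCompletionLinear m)
      (evenFiltration m) (evenFiltration m) where
  complete := exists_sub_sum_mem
  smul_mem := evenFiltration_mul_mem
  antitone := antitone_evenFiltration
  separated x hx := Subtype.ext (Completion.ext_eval fun k => by
    rw [eval_eq_zero_of_mem le_rfl (coe_mem_completionFiltration (hx k))]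
    exact (map_zero _).symm)
  zero_eq := by
    refine eq_top_iff.2 fun x _ k => ?_
    obtain ⟨a, ha, hax⟩ := x.2 k
    exact ⟨⟨a, ha⟩, by simp, hax⟩
  map_mem_ideal hr _ := ⟨_, hr, rfl⟩
  map_mem ha _ := ⟨_, by simpa using ha, rfl⟩
  exists_approx := by
    intro n x hx
    obtain ⟨N, hN⟩ := pow_mem_smul_top (m := m) (n + 1)
    obtain ⟨a, ha, hax⟩ := hx N
    refine ⟨a, by simpa using ha, fun k => ?_⟩
    obtain ⟨b, hb, hbx⟩ := hx (max k N)
    refine ⟨b - a, mem_pow_of_coe_mem_smul_top (hN _ ?_), ?_⟩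
    · rw [even_coe_sub, ← Ideal.Quotient.eq, hax,
        ← Completion.factor_eval m (le_max_right k N), ← hbx, Ideal.Quotient.factor_mk]
    · rw [even_coe_sub, even_coe_sub, map_sub, map_sub,
        ← Completion.factor_eval m (le_max_left k N) x, ← hbx, Ideal.Quotient.factor_mk]
      rfl

/-- The submodule `𝔪₀ⁿA` contains a power of `𝔪`, so it is already closed in `A`. -/
theorem mem_smul_top_of_toCompletion_mem [IsNoetherian (evenPart 𝒜) A] {n : ℕ} {a : A}
    (ha : toCompletion m a ∈ completionFiltration m n) :
    a ∈ evenIdeal m ^ n • (⊤ : Submodule (evenPart 𝒜) A) := by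
  obtain ⟨N, hN⟩ := pow_mem_smul_top (m := m) n
  obtain ⟨b, hb, hba⟩ := ha N
  rw [← sub_add_cancel a b]
  exact add_mem (hN _ (Ideal.Quotient.eq.1 hba.symm)) hb

theorem evenFiltration_le [IsNoetherian (evenPart 𝒜) A] (n : ℕ) :
    evenFiltration m n ≤ (evenIdeal m ^ n).map (evenToCompletion m) := by
  have := isNoetherianRing_evenPart 𝒜
  refine ((isFilteredCompletion_even m).le_span_map n).trans (Submodule.span_mono ?_)
  rintro _ ⟨r, hr, rfl⟩
  exact ⟨r, by simpa using hr, rfl⟩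

theorem map_le_evenFiltration (n : ℕ) :
    (evenIdeal m ^ n).map (evenToCompletion m) ≤ evenFiltration m n := by
  rw [Ideal.map_le_iff_le_comap]
  exact fun r hr k => ⟨r, hr, rfl⟩

theorem isNoetherian_completion [IsNoetherian (evenPart 𝒜) A] :
    IsNoetherian (evenPart (completionGrading m)) (Completion m) := by
  have := isNoetherianRing_evenPart 𝒜
  exact (isFilteredCompletion_completion m).isNoetherian

variable {m}

theorem isLocalRing_completion [IsNoetherian (evenPart 𝒜) A] (hm : IsLocalWith 𝒜 m) :
    ∃ _ : IsLocalRing (evenPart (completionGrading m)),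
      IsLocalRing.maximalIdeal (evenPart (completionGrading m)) =
        (evenIdeal m).map (evenToCompletion m) := by
  obtain ⟨_, hR⟩ := isLocalRing_evenPart hm
  have h := isFilteredCompletion_even m
  rw [← hR] at h
  have h1 : evenFiltration m 1 ≠ ⊤ := by
    intro h1
    obtain ⟨r, hr, hr1⟩ := ((Ideal.eq_top_iff_one _).1 h1) 1
    rw [pow_one] at hr
    refine one_notMem_of_isMaximal hm.1 ?_
    have h2 : (r : A) - 1 ∈ m.toIdeal ^ 1 := Ideal.Quotient.eq.1 (by rw [hr1]; rfl)
    rw [← sub_sub_cancel (r : A) 1]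
    exact sub_mem hr (Ideal.pow_le_self one_ne_zero h2)
  obtain ⟨hS, hS'⟩ := h.isLocalRing (fun _ => rfl) h1
  refine ⟨hS, hS'.trans (le_antisymm ?_ ?_)⟩
  · simpa using evenFiltration_le m 1
  · simpa using map_le_evenFiltration m 1

end CompletionFiltration

/-! ### Annihilator quotients and odd parameters under completion. -/

section OddParameters

open IsLocalRing
open scoped Pointwise

variable {A : Type*} [Ring A] {𝒜 : ZMod 2 → AddSubgroup A} [GradedRing 𝒜] [IsSuperCommutative 𝒜]
  {m : HomogeneousIdeal 𝒜}

theorem mem_evenAnn {x : A} {r : evenPart 𝒜} : r ∈ evenAnn 𝒜 x ↔ (r : A) * x = 0 := Iff.rfl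

theorem evenAnn_zero : evenAnn 𝒜 (0 : A) = ⊤ := by
  ext r; simp [mem_evenAnn]

theorem evenAnn_one : evenAnn 𝒜 (1 : A) = ⊥ := by
  ext r
  rw [mem_evenAnn, mul_one, Ideal.mem_bot, ← Subring.coe_zero, Subtype.ext_iff]

theorem ringKrullDim_quotient_evenAnn_one :
    ringKrullDim (evenPart 𝒜 ⧸ evenAnn 𝒜 (1 : A)) = ringKrullDim (evenPart 𝒜) := by
  rw [evenAnn_one]
  exact ringKrullDim_eq_of_ringEquiv (RingEquiv.quotientBot (evenPart 𝒜))

theorem ringKrullDim_quotient_top {R : Type*} [CommRing R] :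
    ringKrullDim (R ⧸ (⊤ : Ideal R)) = ⊥ := by
  have := Ideal.Quotient.subsingleton_iff.2 (rfl : (⊤ : Ideal R) = ⊤)
  exact ringKrullDim_eq_bot_of_subsingleton

theorem toCompletion_eq_zero [IsNoetherian (evenPart 𝒜) A] (hm : IsLocalWith 𝒜 m) {a : A}
    (ha : toCompletion m a = 0) : a = 0 := by
  have := isNoetherianRing_evenPart 𝒜
  obtain ⟨_, hR⟩ := isLocalRing_evenPart hm
  have h := (maximalIdeal (evenPart 𝒜)).iInf_pow_smul_eq_bot_of_isLocalRing (M := A)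
    (Ideal.IsPrime.ne_top inferInstance)
  rw [← Submodule.mem_bot (evenPart 𝒜), ← h, Submodule.mem_iInf, hR]
  intro n
  refine mem_smul_top_of_toCompletion_mem m ?_
  rw [ha]
  exact zero_mem _

/-- The quotient `A₀ / Ann z` is the cyclic module `A₀z` inside `A`. By Artin–Rees its adic topology
is induced from `A`, which supplies the condition on preimages of powers in
`ringKrullDim_eq_of_dense`. -/
theorem ringKrullDim_quotient_evenAnn [IsNoetherian (evenPart 𝒜) A] (hm : IsLocalWith 𝒜 m)
    (z : A) : ringKrullDim (evenPart 𝒜 ⧸ evenAnn 𝒜 z) =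
      ringKrullDim (evenPart (completionGrading m) ⧸
        evenAnn (completionGrading m) (toCompletion m z)) := by
  -- For `z = 0` both quotients are zero rings, hence not local.
  by_cases hz : z = 0
  · rw [hz, map_zero, evenAnn_zero, evenAnn_zero, ringKrullDim_quotient_top,
      ringKrullDim_quotient_top]
  have hR := isNoetherianRing_evenPart 𝒜
  have hC := isNoetherian_completion m
  have hS := isNoetherianRing_evenPart (completionGrading m)
  obtain ⟨hRl, hRm⟩ := isLocalRing_evenPart hm
  obtain ⟨hSl, hSm⟩ := isLocalRing_completion hm
  set φ := evenToCompletion m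
  set I := evenAnn 𝒜 z
  set J := evenAnn (completionGrading m) (toCompletion m z)
  have hIJ : I ≤ J.comap φ := by
    intro r hr
    rw [Ideal.mem_comap, mem_evenAnn, evenToCompletion_coe, ← map_mul, mem_evenAnn.1 hr, map_zero]
  have hI : Nontrivial (evenPart 𝒜 ⧸ I) := by
    rw [Ideal.Quotient.nontrivial_iff, Ne, Ideal.eq_top_iff_one, mem_evenAnn]
    exact fun h => hz (by simpa using h)
  have hJ : Nontrivial (evenPart (completionGrading m) ⧸ J) := by
    rw [Ideal.Quotient.nontrivial_iff, Ne, Ideal.eq_top_iff_one, mem_evenAnn]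
    exact fun h => hz (toCompletion_eq_zero hm (by simpa using h))
  have hIl : IsLocalRing (evenPart 𝒜 ⧸ I) :=
    IsLocalRing.of_surjective' _ Ideal.Quotient.mk_surjective
  have hJl : IsLocalRing (evenPart (completionGrading m) ⧸ J) :=
    IsLocalRing.of_surjective' _ Ideal.Quotient.mk_surjective
  have hmI := map_maximalIdeal_of_surjective _ (Ideal.Quotient.mk_surjective (I := I))
  have hmJ := map_maximalIdeal_of_surjective _ (Ideal.Quotient.mk_surjective (I := J))
  rw [hRm] at hmI
  rw [hSm] at hmJ
  have hpow : ∀ n, evenFiltration m n = (evenIdeal m).map φ ^ n := by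
    intro n
    rw [← Ideal.map_pow]
    exact le_antisymm (evenFiltration_le m n) (map_le_evenFiltration m n)
  refine ringKrullDim_eq_of_dense (Ideal.quotientMap J φ hIJ) ?_ ?_ ?_
  · rw [← hmI, ← hmJ, Ideal.map_map, Ideal.map_map, Ideal.quotientMap_comp_mk]
  · intro n x
    obtain ⟨s, rfl⟩ := Ideal.Quotient.mk_surjective x
    obtain ⟨r, hr⟩ := (isFilteredCompletion_even m).exists_sub_mem n s
    refine ⟨Ideal.Quotient.mk I r, ?_⟩
    rw [Ideal.quotientMap_mk, ← map_sub, ← hmJ, ← Ideal.map_pow, ← hpow]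
    exact Ideal.mem_map_of_mem _ hr
  · intro n
    obtain ⟨c, hc⟩ := (evenIdeal m).exists_pow_inf_eq_pow_smul (Submodule.span (evenPart 𝒜) {z})
    refine ⟨n + c, fun b hb => ?_⟩
    obtain ⟨r, rfl⟩ := Ideal.Quotient.mk_surjective b
    rw [Ideal.quotientMap_mk, ← hmJ, ← Ideal.map_pow, ← hpow,
      Ideal.mem_map_iff_of_surjective _ Ideal.Quotient.mk_surjective] at hb
    obtain ⟨f, hf, hfr⟩ := hb
    -- `f` and the image of `r` agree modulo the annihilator, so the depth of `f` passes to `r • z`;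
    -- Artin–Rees then costs only the shift `c`.
    have h1 : f • toCompletion m z = toCompletion m (r • z) := by
      have := mem_evenAnn.1 (Ideal.Quotient.eq.1 hfr)
      rw [even_coe_sub, sub_mul, sub_eq_zero] at this
      rw [even_smul_def, this, even_smul_def, map_mul]
      rfl
    have h2 : r • z ∈ evenIdeal m ^ (n + c) • (⊤ : Submodule (evenPart 𝒜) A) := by
      refine mem_smul_top_of_toCompletion_mem m ?_
      rw [← h1]
      refine evenFiltration_smul_mem (l := 0) hf ?_
      rw [(isFilteredCompletion_completion m).zero_eq]
      trivial
    have h3 := hc (n + c) (Nat.le_add_left _ _)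
    rw [Nat.add_sub_cancel] at h3
    have h4 : r • z ∈ evenIdeal m ^ n • Submodule.span (evenPart 𝒜) {z} :=
      (h3.le.trans (smul_mono_right _ inf_le_right))
        ⟨h2, Submodule.smul_mem _ _ (Submodule.mem_span_singleton_self z)⟩
    obtain ⟨y, hy, hyz⟩ := Submodule.mem_smul_span_singleton.1 h4
    have h5 : Ideal.Quotient.mk I r = Ideal.Quotient.mk I y := by
      rw [Ideal.Quotient.eq, mem_evenAnn, even_coe_sub, sub_mul, sub_eq_zero]
      exact hyz.symm
    rw [h5, ← hmI, ← Ideal.map_pow]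
    exact Ideal.mem_map_of_mem _ hy

theorem ringKrullDim_evenPart_completion [IsNoetherian (evenPart 𝒜) A] (hm : IsLocalWith 𝒜 m) :
    ringKrullDim (evenPart 𝒜) = ringKrullDim (evenPart (completionGrading m)) := by
  have h := ringKrullDim_quotient_evenAnn hm (1 : A)
  rwa [map_one, ringKrullDim_quotient_evenAnn_one, ringKrullDim_quotient_evenAnn_one] at h

/-- If the odd part of `B` is spanned by a finite set `Z` and `B` has a system of odd parameters
of length `s`, then there is one consisting of elements of `Z`. -/
theorem exists_isSystemOfOddParameters_mem {B : Type*} [Ring B] (ℬ : ZMod 2 → AddSubgroup B)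
    [GradedRing ℬ] [IsSuperCommutative ℬ] [FiniteRingKrullDim (evenPart ℬ)] (Z : Set B)
    (hZ : Z.Finite) (hspan : gradedPart ℬ 1 ≤ Submodule.span (evenPart ℬ) Z) {s : ℕ} {y : Fin s → B}
    (hy : IsSystemOfOddParameters ℬ y) : ∃ z : Fin s → Z,
      ringKrullDim (evenPart ℬ) =
        ringKrullDim (evenPart ℬ ⧸ evenAnn ℬ (List.ofFn fun i => (z i : B)).prod) := by
  have hfin : (Z ^ s).Finite := by
    clear hy y
    induction s with
    | zero => rw [pow_zero]; exact Set.finite_one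
    | succ s ih => rw [pow_succ]; exact ih.mul hZ
  have hprod : (List.ofFn y).prod ∈ Submodule.span (evenPart ℬ) (Z ^ s) := by
    rw [← Submodule.span_pow]
    exact Submodule.pow_subset_pow _ (Set.mem_pow.2 ⟨fun i => ⟨y i, hspan (hy.1 i)⟩, rfl⟩)
  -- An even element killing every product of `s` elements of `Z` kills the product of the `y i`,
  -- which is a combination of them.
  obtain ⟨w, hw, hdim⟩ := exists_ringKrullDim_quotient_eq hfin.toFinset (evenAnn ℬ)
    (evenAnn ℬ (List.ofFn y).prod) (by
      intro r hr
      rw [Submodule.mem_finsetInf] at hr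
      rw [mem_evenAnn]
      generalize (List.ofFn y).prod = p at hprod
      induction hprod using Submodule.span_induction with
      | mem x hx => exact hr x (hfin.mem_toFinset.2 hx)
      | zero => rw [mul_zero]
      | add x y _ _ hx hy => rw [mul_add, hx, hy, add_zero]
      | smul c x _ hx => rw [even_smul_def, ← mul_assoc, even_comm r.2, mul_assoc, hx, mul_zero])
    hy.2
  obtain ⟨z, rfl⟩ := Set.mem_pow.1 (hfin.mem_toFinset.1 hw)
  exact ⟨z, hdim⟩

/-- The image of `A` spans the completion over its even part; projecting to odd components, which
commutes with completion, leaves the images of odd elements. -/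
theorem gradedPart_completion_le [IsNoetherian (evenPart 𝒜) A] {Z : Set A}
    (hZ : Submodule.span (evenPart 𝒜) Z = gradedPart 𝒜 1) :
    gradedPart (completionGrading m) 1 ≤
      Submodule.span (evenPart (completionGrading m)) (toCompletion m '' Z) := by
  intro x hx
  have := isNoetherianRing_evenPart 𝒜
  have h := (isFilteredCompletion_completion m).le_span_map 0
  rw [(isFilteredCompletion_completion m).zero_eq] at h
  have h1 := Submodule.mem_map_of_mem (f := projLinear (completionGrading m) 1) (h (x := x) trivial)
  rw [Submodule.map_span] at h1
  have h2 : projLinear (completionGrading m) 1 x = x := proj_of_mem hx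
  rw [h2] at h1
  refine Submodule.span_le.2 ?_ h1
  rintro _ ⟨_, ⟨a, -, rfl⟩, rfl⟩
  have h3 : projLinear (completionGrading m) 1 (toCompletionLinear m a) =
      toCompletionLinear m (GradedRing.proj 𝒜 1 a) := by
    change GradedRing.proj _ 1 (toCompletion m a) = toCompletion m (GradedRing.proj 𝒜 1 a)
    conv_lhs => rw [← proj_add_proj 𝒜 a, map_add, map_add]
    rw [proj_of_mem (toCompletion_mem m (proj_mem 𝒜 1 a)),
      proj_of_mem_ne (toCompletion_mem m (proj_mem 𝒜 0 a)) (by decide), zero_add]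
  rw [h3]
  have h4 : GradedRing.proj 𝒜 1 a ∈ Submodule.span (evenPart 𝒜) Z := by
    rw [hZ]; exact proj_mem 𝒜 1 a
  generalize GradedRing.proj 𝒜 1 a = p at h4
  induction h4 using Submodule.span_induction with
  | mem z hz => exact Submodule.subset_span ⟨z, hz, rfl⟩
  | zero => rw [map_zero]; exact zero_mem _
  | add x y _ _ hx hy => rw [map_add]; exact add_mem hx hy
  | smul c x _ hx => rw [map_smulₛₗ]; exact Submodule.smul_mem _ _ hx

theorem toCompletion_prod_ofFn {s : ℕ} (z : Fin s → A) :
    toCompletion m (List.ofFn z).prod = (List.ofFn fun i => toCompletion m (z i)).prod := by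
  rw [map_list_prod, List.map_ofFn]
  rfl

theorem exists_isSystemOfOddParameters_iff [IsNoetherian (evenPart 𝒜) A] (hm : IsLocalWith 𝒜 m)
    (s : ℕ) : (∃ y : Fin s → A, IsSystemOfOddParameters 𝒜 y) ↔
      ∃ y : Fin s → Completion m, IsSystemOfOddParameters (completionGrading m) y := by
  constructor
  · rintro ⟨y, hy, hdim⟩
    refine ⟨fun i => toCompletion m (y i), fun i => toCompletion_mem m (hy i), ?_⟩
    rw [← ringKrullDim_evenPart_completion hm, hdim, ringKrullDim_quotient_evenAnn hm,
      toCompletion_prod_ofFn]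
  · rintro ⟨y, hy⟩
    have hC := isNoetherian_completion m
    have hS := isNoetherianRing_evenPart (completionGrading m)
    obtain ⟨hSl, -⟩ := isLocalRing_completion hm
    obtain ⟨Z, hZ⟩ := IsNoetherian.noetherian (gradedPart 𝒜 1)
    obtain ⟨z, hz⟩ := exists_isSystemOfOddParameters_mem (completionGrading m) _
      (Z.finite_toSet.image _) (gradedPart_completion_le hZ) hy
    choose w hw hwz using fun i => (z i).2
    refine ⟨w, fun i => ?_, ?_⟩
    · rw [← mem_gradedPart, ← hZ]
      exact Submodule.subset_span (hw i)
    · rw [ringKrullDim_evenPart_completion hm, hz, ringKrullDim_quotient_evenAnn hm,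
        toCompletion_prod_ofFn]
      rw [show (fun i => ((z i : _) : Completion m)) = fun i => toCompletion m (w i) from
        funext fun i => (hwz i).symm]

/-- Long products of odd elements vanish. Their annihilator is then everything, and the zero
quotient has dimension `⊥`, unlike the nontrivial ring `A₀`. -/
theorem oddKrullDim_ne_top [IsNoetherian (evenPart 𝒜) A] [Nontrivial (evenPart 𝒜)] :
    oddKrullDim 𝒜 ≠ ⊤ := by
  obtain ⟨k, hk⟩ := exists_gradedPart_pow_eq_bot 𝒜
  refine ne_top_of_le_ne_top (ENat.natCast_ne_top k) (iSup₂_le fun s hs => ?_)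
  obtain ⟨y, hy, hdim⟩ := hs
  by_contra hlt
  have hks : k ≤ s := by
    rw [not_le] at hlt
    exact_mod_cast hlt.le
  have h0 : (List.ofFn y).prod ∈ gradedPart 𝒜 1 ^ s :=
    Submodule.pow_subset_pow _ (Set.mem_pow.2 ⟨fun i => ⟨y i, hy i⟩, rfl⟩)
  have hs : gradedPart 𝒜 1 ^ s = ⊥ := by
    rw [← Nat.add_sub_of_le hks, pow_add, hk, Submodule.bot_mul]
  rw [hs, Submodule.mem_bot] at h0
  rw [h0, evenAnn_zero, ringKrullDim_quotient_top] at hdim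
  have := ringKrullDim_nonneg_of_nontrivial (R := evenPart 𝒜)
  rw [hdim] at this
  simp at this

end OddParameters

end SuperRing

theorem mainTheorem5 {A : Type*} [Ring A] (𝒜 : ZMod 2 → AddSubgroup A) [GradedRing 𝒜]
    [IsSuperCommutative 𝒜] (hA : SuperRing.IsNoetherianSuper 𝒜)
    (m : HomogeneousIdeal 𝒜) (hm : SuperRing.IsLocalWith 𝒜 m) :
    SuperRing.IsNoetherianSuper (SuperRing.completionGrading m) ∧
    (∃ r s : ℕ, SuperRing.Ksdim 𝒜 = ((r : WithBot ℕ∞), (s : ℕ∞))) ∧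
    SuperRing.Ksdim 𝒜 = SuperRing.Ksdim (SuperRing.completionGrading m) ∧
    SuperRing.evenKrullDim 𝒜 = SuperRing.evenKrullDim (SuperRing.completionGrading m) ∧
    SuperRing.oddKrullDim 𝒜 = SuperRing.oddKrullDim (SuperRing.completionGrading m) := by
  have hN := SuperRing.isNoetherian_evenPart hA
  have hR := SuperRing.isNoetherianRing_evenPart 𝒜
  have hC := SuperRing.isNoetherian_completion m
  obtain ⟨hRl, -⟩ := SuperRing.isLocalRing_evenPart hm
  have heven : SuperRing.evenKrullDim 𝒜 =
      SuperRing.evenKrullDim (SuperRing.completionGrading m) :=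
    SuperRing.ringKrullDim_evenPart_completion hm
  have hodd : SuperRing.oddKrullDim 𝒜 =
      SuperRing.oddKrullDim (SuperRing.completionGrading m) := by
    -- Both suprema run over the same set of lengths.
    simp only [SuperRing.oddKrullDim, SuperRing.exists_isSystemOfOddParameters_iff hm]
  refine ⟨SuperRing.isNoetherianSuper_of_isNoetherian _, ?_, Prod.ext heven hodd, heven, hodd⟩
  obtain ⟨s, hs⟩ := ENat.ne_top_iff_exists.1 (SuperRing.oddKrullDim_ne_top (𝒜 := 𝒜))
  obtain ⟨t, -, -, -, ht⟩ := SuperRing.exists_finset_pow_le_span (SuperRing.evenPart 𝒜)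
  exact ⟨t.card, s, Prod.ext ht hs.symm⟩
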